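/- **Setting.** Let $G=(V,E)$ be a graph on $V=\{1,\dots,p\}$ in which every node has degree at most $d$, where $d\ge 1$, and let $0<\alpha\le\beta$, $h\ge 0$. The Ising model on $G$ with couplings $\theta_{ij}=\theta_{ji}$, $\alpha\le|\theta_{ij}|\le\beta$ for $\{i,j\}\in E$, $\theta_{ij}=0$ for $\{i,j\}\notin E$, and fields $|\theta_i|\le h$ is the law on $\{-1,+1\}^V$ with $$P(x)\propto\exp\Big(\sum_{\{i,j\}\in E}\theta_{ij}x_ix_j+\sum_{i\in V}\theta_ix_i\Big).$$ Given samples $X^{(1)},\dots,X^{(n)}\in\{-1,+1\}^V$, let $\widehat P$ be their empirical distribution (conditional probabilities given events of empirical probability $0$ are read as $0$). For $u\in V$, $S\subseteq V$ and $i\notin S\cup\{u\}$ let $$\widehat\nu_{u|i;x_S}=\widehat P(X_u=+\mid X_i=+,X_S=x_S)-\widehat P(X_u=+\mid X_i=-,X_S=x_S),$$ $$\widehat\lambda_i(x_S)=2\,\widehat P(X_i=+\mid X_S=x_S)\,\widehat P(X_i=-\mid X_S=x_S),\qquad \widehat\nu^{\rm avg}_{u|i;S}=\frac1n\sum_{t=1}^n\widehat\lambda_i(X^{(t)}_S)\,\big|\widehat\nu_{u|i;X^{(t)}_S}\big|,$$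 and put $\widehat\nu^{\rm avg}_{u|i;S}=0$ if $i\in S\cup\{u\}$. The algorithm LearnNbhd$(X^{(1)},\dots,X^{(n)},\tau,u)$ starts with $S=\varnothing$; as long as $\max_i\widehat\nu^{\rm avg}_{u|i;S}\ge\tau$ it adds a maximizer $i$ to $S$ (ties broken arbitrarily); then, for each element $i$ of the resulting set, in any order, it removes $i$ from the current set $S$ if $\widehat\nu^{\rm avg}_{u|i;S\setminus\{i\}}<\tau$; it outputs $S$. Running time is the number of steps on a random access machine with unit-cost arithmetic on real numbers: programs are built from elementary instructions by sequencing, branching and while loops, every elementary instruction and every test costs one step, natural-number registers can be added, subtracted and compared, real registers can be added, subtracted, multiplied, divided and compared, and the entries of the sample matrix and of arrays are accessed in one step. Let $$\delta=\tfrac12e^{-2(\beta d+h)},\quad \tau^*=\frac{\alpha^2\delta^{4d+1}}{16d\beta},\quad \epsilon^*=\frac{\tau^*}2,\quad \ell^*=\frac8{(\tau^*)^2},\quad N(p)=\frac{144(\ell^*+3)}{(\epsilon^*)^2\delta^{2\ell^*}}\log\frac p\zeta .$$ **Theorem.** There are a program that implements LearnNbhd (for all $p,n$, all samples, all $u$ and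 all $\tau>0$ it halts with a possible output of LearnNbhd) and numerical constants $C,c,c',c''>0$ such that for all $d\ge1$, $0<\alpha\le\beta$, $h\ge0$ and $\zeta>0$ the following hold. 1. $\displaystyle\frac{144(\ell^*+3)}{(\epsilon^*)^2\delta^{2\ell^*}}\le\exp\big\{c\,\alpha^{-c'}e^{c''d(\beta d+h+1)}\big\}$. 2. For all $p$, $n$, $G$ and $\theta$ as above with $n\ge N(p)$, if $X^{(1)},\dots,X^{(n)}$ are i.i.d. samples from the Ising model, then with probability at least $1-\zeta$, for every node $u$: LearnNbhd$(X^{(1)},\dots,X^{(n)},\tau^*,u)$ returns exactly the neighborhood of $u$ (however ties are broken), and the running time of the program on this input is at most $C\ell^*pn$. 3. There is a constant $K$, depending only on $d,\alpha,\beta,h,\zeta$, such that for all $p\ge2$, $n=\lceil N(p)\rceil$ (read as $0$ if $N(p)<0$), $G$ and $\theta$ as above, with probability at least $1-\zeta$ all neighborhoods are returned correctly, the running time is at most $K\,p\log p$ for each node, and at most $K\,p^2\log p$ in total over all nodes. -/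

import Mathlib

open MeasureTheory

namespace IsingLearn

/-! ### The Ising model -/

/-- A spin configuration; `true` stands for `+1` and `false` for `-1`. -/
abbrev Config (p : ℕ) : Type := Fin p → Bool

/-- `n` observed configurations. -/
abbrev Samples (p n : ℕ) : Type := Fin n → Config p

/-- The numerical value of a spin. -/
def spin (b : Bool) : ℝ := if b then 1 else -1

/-- A parameter vector: symmetric couplings `θ_{ij}` and external fields `θ_i`. -/
structure Param (p : ℕ) where
  coupling : Fin p → Fin p → ℝ
  symm : ∀ i j, coupling i j = coupling j i
  field : Fin p → ℝ

/-- `θ ∈ Ω_{α,β,h}(G)`. -/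
structure Param.Valid {p : ℕ} (θ : Param p) (G : SimpleGraph (Fin p)) (α β h : ℝ) : Prop where
  field_le : ∀ i, |θ.field i| ≤ h
  coupling_ge : ∀ i j, G.Adj i j → α ≤ |θ.coupling i j|
  coupling_le : ∀ i j, G.Adj i j → |θ.coupling i j| ≤ β
  coupling_eq_zero : ∀ i j, ¬ G.Adj i j → θ.coupling i j = 0

/-- `∑_{i<j} θ_{ij} x_i x_j + ∑_i θ_i x_i`. -/
noncomputable def Param.energy {p : ℕ} (θ : Param p) (x : Config p) : ℝ :=
  (∑ q : Fin p × Fin p with q.1 < q.2, θ.coupling q.1 q.2 * (spin (x q.1) * spin (x q.2)))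
    + ∑ i, θ.field i * spin (x i)

/-- The partition function `exp Φ(θ)`. -/
noncomputable def Param.partition {p : ℕ} (θ : Param p) : ℝ :=
  ∑ x : Config p, Real.exp (θ.energy x)

theorem Param.partition_pos {p : ℕ} (θ : Param p) : 0 < θ.partition :=
  Finset.sum_pos (fun x _ => Real.exp_pos (θ.energy x)) Finset.univ_nonempty

/-- The probability mass function of the Ising model. -/
noncomputable def Param.pmf {p : ℕ} (θ : Param p) : PMF (Config p) :=
  PMF.ofFintype (fun x => ENNReal.ofReal (Real.exp (θ.energy x) / θ.partition)) (by
    rw [← ENNReal.ofReal_sum_of_nonneg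
      (fun x _ => div_nonneg (Real.exp_pos _).le θ.partition_pos.le), ← Finset.sum_div]
    have h : (∑ x : Config p, Real.exp (θ.energy x)) / θ.partition = 1 :=
      div_self θ.partition_pos.ne'
    rw [h, ENNReal.ofReal_one])

/-- The joint law of `n` independent samples from the Ising model. -/
noncomputable def Param.sampleLaw {p : ℕ} (θ : Param p) (n : ℕ) : Measure (Samples p n) :=
  Measure.pi fun _ : Fin n => θ.pmf.toMeasure

/-! ### Empirical influences -/

section Empirical

variable {p n : ℕ}

/-- The expectation of `f` under the empirical measure. -/
noncomputable def empMean (X : Samples p n) (f : Config p → ℝ) : ℝ :=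
  (1 / (n : ℝ)) * ∑ t, f (X t)

/-- The empirical probability of an event. -/
noncomputable def empProb (X : Samples p n) (A : Set (Config p)) : ℝ :=
  empMean X (A.indicator 1)

/-- The empirical conditional probability of `A` given `B`. It is `0` if `B` has empirical
probability `0`; in `empInfluence` such terms have weight `empWeight = 0`. -/
noncomputable def empCond (X : Samples p n) (A B : Set (Config p)) : ℝ :=
  empProb X (A ∩ B) / empProb X B

/-- The event that the spin at `i` equals `b`. -/
def spinEvent (i : Fin p) (b : Bool) : Set (Config p) := {y | y i = b}

/-- The event that the configuration agrees with `x` on `S`. -/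
def agreeEvent (S : Finset (Fin p)) (x : Config p) : Set (Config p) := {y | ∀ j ∈ S, y j = x j}

/-- The empirical conditional influence of `i` on `u` given `X_S = x_S`. -/
noncomputable def empNu (X : Samples p n) (u i : Fin p) (S : Finset (Fin p)) (x : Config p) : ℝ :=
  empCond X (spinEvent u true) (spinEvent i true ∩ agreeEvent S x)
    - empCond X (spinEvent u true) (spinEvent i false ∩ agreeEvent S x)

/-- The weight `2 P̂(X_i = + | X_S = x_S) P̂(X_i = - | X_S = x_S)`. -/
noncomputable def empWeight (X : Samples p n) (i : Fin p) (S : Finset (Fin p)) (x : Config p) : ℝ :=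
  2 * empCond X (spinEvent i true) (agreeEvent S x) * empCond X (spinEvent i false) (agreeEvent S x)

/-- The empirical average conditional influence of `i` on `u` given `S`, set to `0` if
`i ∈ S ∪ {u}`. -/
noncomputable def empInfluence (X : Samples p n) (u i : Fin p) (S : Finset (Fin p)) : ℝ :=
  if i ∈ insert u S then 0
  else empMean X fun x => empWeight X i S x * |empNu X u i S x|

/-! ### The algorithm

Ties in the maximization and the order of the pruning loop are left open: the algorithm is a
relation between inputs and possible outputs. -/

/-- The sets that the greedy phase can build, starting from `∅` and adding a node of maximal
empirical influence as long as that influence is at least `τ`. -/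
inductive GreedyReach (X : Samples p n) (τ : ℝ) (u : Fin p) : Finset (Fin p) → Prop
  | empty : GreedyReach X τ u ∅
  | add (S : Finset (Fin p)) (i : Fin p) : GreedyReach X τ u S →
      (∀ j, empInfluence X u j S ≤ empInfluence X u i S) → τ ≤ empInfluence X u i S →
      GreedyReach X τ u (insert i S)

/-- `S` is a possible result of the pseudo-neighborhood phase: it has been built greedily, and no
influence reaches the threshold any more. -/
def PseudoNbhd (X : Samples p n) (τ : ℝ) (u : Fin p) (S : Finset (Fin p)) : Prop :=
  GreedyReach X τ u S ∧ ∀ i, empInfluence X u i S < τ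

/-- One pruning step: remove `i` from the current set `S` if its influence given `S \ {i}` is
below the threshold. -/
noncomputable def pruneStep (X : Samples p n) (τ : ℝ) (u : Fin p) (S : Finset (Fin p)) (i : Fin p) :
    Finset (Fin p) :=
  if empInfluence X u i (S.erase i) < τ then S.erase i else S

/-- `LearnNbhd X τ u R`: the set `R` is a possible output of the algorithm on the samples `X`, the
threshold `τ` and the node `u`. The list `l` is the order in which the pruning loop runs through the
pseudo-neighborhood. -/
def LearnNbhd (X : Samples p n) (τ : ℝ) (u : Fin p) (R : Finset (Fin p)) : Prop :=
  ∃ (S : Finset (Fin p)) (l : List (Fin p)), PseudoNbhd X τ u S ∧ l.Nodup ∧ l.toFinset = S ∧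
    R = l.foldl (pruneStep X τ u) S

end Empirical

/-! ### A random access machine with real arithmetic

Programs are structured (sequence, branching, `while` loops) and act on registers and arrays of
natural numbers (for counters and addresses) and of real numbers. Every elementary instruction and
every test costs one step. Natural numbers are only added, subtracted and compared; real numbers are
added, subtracted, multiplied, divided and compared, and a natural number can be converted to a
real number, but not conversely. -/

/-- The memory. -/
structure Store where
  nat : ℕ → ℕ
  arr : ℕ → ℕ → ℕ
  real : ℕ → ℝ
  rarr : ℕ → ℕ → ℝ

/-- Elementary instructions; the arguments are names of registers and arrays, apart from the
literal `k` in `const`. -/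
inductive Op
  /-- `nat[x] := k` -/
  | const (x k : ℕ)
  /-- `nat[x] := nat[y] + nat[z]` -/
  | add (x y z : ℕ)
  /-- `nat[x] := nat[y] - nat[z]` (truncated) -/
  | sub (x y z : ℕ)
  /-- `nat[x] := arr[a][nat[y]]` -/
  | load (x a y : ℕ)
  /-- `arr[a][nat[y]] := nat[x]` -/
  | store (a y x : ℕ)
  /-- `nat[x] :=` entry `(nat[y], nat[z])` of the input matrix -/
  | input (x y z : ℕ)
  /-- `real[r] := nat[x]` -/
  | cast (r x : ℕ)
  /-- `real[r] := real[a] + real[b]` -/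
  | radd (r a b : ℕ)
  /-- `real[r] := real[a] - real[b]` -/
  | rsub (r a b : ℕ)
  /-- `real[r] := real[a] * real[b]` -/
  | rmul (r a b : ℕ)
  /-- `real[r] := real[a] / real[b]` -/
  | rdiv (r a b : ℕ)
  /-- `real[r] := rarr[a][nat[y]]` -/
  | rload (r a y : ℕ)
  /-- `rarr[a][nat[y]] := real[r]` -/
  | rstore (a y r : ℕ)

/-- The effect of an elementary instruction; `D` is the read-only input matrix. -/
noncomputable def Op.apply (D : ℕ → ℕ → ℕ) (s : Store) : Op → Store
  | const x k => { s with nat := Function.update s.nat x k }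
  | add x y z => { s with nat := Function.update s.nat x (s.nat y + s.nat z) }
  | sub x y z => { s with nat := Function.update s.nat x (s.nat y - s.nat z) }
  | load x a y => { s with nat := Function.update s.nat x (s.arr a (s.nat y)) }
  | store a y x =>
      { s with arr := Function.update s.arr a (Function.update (s.arr a) (s.nat y) (s.nat x)) }
  | input x y z => { s with nat := Function.update s.nat x (D (s.nat y) (s.nat z)) }
  | cast r x => { s with real := Function.update s.real r (s.nat x : ℝ) }
  | radd r a b => { s with real := Function.update s.real r (s.real a + s.real b) }
  | rsub r a b => { s with real := Function.update s.real r (s.real a - s.real b) }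
  | rmul r a b => { s with real := Function.update s.real r (s.real a * s.real b) }
  | rdiv r a b => { s with real := Function.update s.real r (s.real a / s.real b) }
  | rload r a y => { s with real := Function.update s.real r (s.rarr a (s.nat y)) }
  | rstore a y r =>
      { s with rarr := Function.update s.rarr a (Function.update (s.rarr a) (s.nat y) (s.real r)) }

/-- Elementary tests on registers. -/
inductive Test
  | natLt (x y : ℕ)
  | natEq (x y : ℕ)
  | realLt (a b : ℕ)

/-- The truth value of a test. -/
def Test.Holds (s : Store) : Test → Prop
  | natLt x y => s.nat x < s.nat y
  | natEq x y => s.nat x = s.nat y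
  | realLt a b => s.real a < s.real b

/-- Programs. -/
inductive Prog
  | skip
  | op (o : Op)
  | seq (c₁ c₂ : Prog)
  | ite (b : Test) (c₁ c₂ : Prog)
  | loop (b : Test) (c : Prog)

/-- `Run D c s t s'`: with input matrix `D`, the program `c` started in the memory `s` halts after
exactly `t` steps in the memory `s'`; `loop b c` is `while b do c`. -/
inductive Run (D : ℕ → ℕ → ℕ) : Prog → Store → ℕ → Store → Prop
  | skip (s : Store) : Run D .skip s 1 s
  | op (o : Op) (s : Store) : Run D (.op o) s 1 (o.apply D s)
  | seq {c₁ c₂ : Prog} {s s₁ s₂ : Store} {t₁ t₂ : ℕ} : Run D c₁ s t₁ s₁ → Run D c₂ s₁ t₂ s₂ →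
      Run D (.seq c₁ c₂) s (t₁ + t₂) s₂
  | ite_true {b : Test} {c₁ c₂ : Prog} {s s' : Store} {t : ℕ} : b.Holds s → Run D c₁ s t s' →
      Run D (.ite b c₁ c₂) s (t + 1) s'
  | ite_false {b : Test} {c₁ c₂ : Prog} {s s' : Store} {t : ℕ} : ¬ b.Holds s → Run D c₂ s t s' →
      Run D (.ite b c₁ c₂) s (t + 1) s'
  | loop_true {b : Test} {c : Prog} {s s₁ s₂ : Store} {t₁ t₂ : ℕ} : b.Holds s → Run D c s t₁ s₁ →
      Run D (.loop b c) s₁ t₂ s₂ → Run D (.loop b c) s (t₁ + t₂ + 1) s₂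
  | loop_false {b : Test} {c : Prog} {s : Store} : ¬ b.Holds s → Run D (.loop b c) s 1 s

/-- The samples as input matrix: entry `(t, i)` is `1` if the `t`-th sample has spin `+` at node
`i`, and `0` otherwise. -/
def inputMatrix {p n : ℕ} (X : Samples p n) (t i : ℕ) : ℕ :=
  if h : t < n ∧ i < p then (if X ⟨t, h.1⟩ ⟨i, h.2⟩ then 1 else 0) else 0

/-- The initial memory: `p`, `n`, `u` in the first three natural registers, `τ` in the first real
register, and zeros elsewhere. -/
noncomputable def initStore (p n : ℕ) (τ : ℝ) (u : Fin p) : Store where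
  nat := fun x => if x = 0 then p else if x = 1 then n else if x = 2 then (u : ℕ) else 0
  arr := fun _ _ => 0
  real := fun r => if r = 0 then τ else 0
  rarr := fun _ _ => 0

/-- On the samples `X`, the threshold `τ` and the node `u`, the program `c` halts after exactly `t`
steps, and the first `p` cells of array `0` then hold the indicator function of `R`. -/
def Returns {p n : ℕ} (c : Prog) (X : Samples p n) (τ : ℝ) (u : Fin p) (t : ℕ)
    (R : Finset (Fin p)) : Prop :=
  ∃ s : Store, Run (inputMatrix X) c (initStore p n τ u) t s ∧
    ∀ j : Fin p, s.arr 0 (j : ℕ) = if j ∈ R then 1 else 0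

/-! ### The constants -/

/-- `δ = e^{-2(βd+h)} / 2`. -/
noncomputable def delta (d : ℕ) (β h : ℝ) : ℝ := 1 / 2 * Real.exp (-2 * (β * d + h))

/-- `τ* = α² δ^{4d+1} / (16 d β)`. -/
noncomputable def tauStar (d : ℕ) (α β h : ℝ) : ℝ :=
  α ^ 2 * delta d β h ^ (4 * d + 1) / (16 * d * β)

/-- `ε* = τ* / 2`. -/
noncomputable def epsStar (d : ℕ) (α β h : ℝ) : ℝ := tauStar d α β h / 2

/-- `ℓ* = 8 / (τ*)²`. -/
noncomputable def ellStar (d : ℕ) (α β h : ℝ) : ℝ := 8 / tauStar d α β h ^ 2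

/-- `144 (ℓ* + 3) / ((ε*)² δ^{2ℓ*})`. -/
noncomputable def sampleCoeff (d : ℕ) (α β h : ℝ) : ℝ :=
  144 * (ellStar d α β h + 3) /
    (epsStar d α β h ^ 2 * delta d β h ^ (2 * ellStar d α β h))

/-- The number of samples that suffices: `144 (ℓ* + 3) / ((ε*)² δ^{2ℓ*}) · log (p / ζ)`. -/
noncomputable def sampleBound (d : ℕ) (α β h ζ : ℝ) (p : ℕ) : ℝ :=
  sampleCoeff d α β h * Real.log (p / ζ)

end IsingLearn

/-!
Adding a node `i` to `S` raises the empirical mean of the square of `P̂(X_u = + | X_S)` by a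
between-group variance, which by Cauchy–Schwarz is at least the square of the average influence of
`i`. As this potential is at most `1`, the greedy phase adds at most `1 / τ²` nodes. Up to that
size of `S`, the average influence is a Lipschitz function of the probabilities of events fixing
few spins: it is twice the sum over `y` of the absolute covariances of the events `X_u = +` and
`X_i = +` on `{X_S = y}`. Hoeffding's inequality and a union bound hence put the empirical
influences within `τ* / 2` of the true ones. Under the Ising law, the spin at `u` may be replaced
in such a covariance by the `tanh` of the local field at `u`. If `S` contains the neighborhood of
`u`, this is constant on `{X_S = y}`, and the influences of all other nodes vanish. Otherwise the
covariance of the local field with its `tanh` is at least a multiple of the variance of the local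
field, which is bounded below because a neighbor outside `S` can be flipped at bounded cost; as
the local field is a combination of the spins of the neighbors, some neighbor outside `S` has true
influence at least `2 τ*`. So the greedy phase stops only when `S` contains the neighborhood, and
pruning keeps exactly the neighborhood. For the running time, the program stores a code of the
restriction of each sample to `S`, so that one influence costs `O(n)` steps and one round of the
greedy phase costs `O(p n)`.
-/

namespace IsingLearn

/-! ### Running-time logic -/

/-- A memory location that a program can write to: a register or a whole array. -/
inductive Loc
  | nat (x : ℕ)
  | arr (a : ℕ)
  | real (r : ℕ)
  | rarr (a : ℕ)
  deriving DecidableEq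

/-- The location that an elementary instruction writes to. -/
def Op.target : Op → Loc
  | const x _ | add x _ _ | sub x _ _ | load x _ _ | input x _ _ => .nat x
  | store a _ _ => .arr a
  | cast r _ | radd r _ _ | rsub r _ _ | rmul r _ _ | rdiv r _ _ | rload r _ _ => .real r
  | rstore a _ _ => .rarr a

/-- The locations that occur as targets of instructions in a program, whether or not a run reaches
these instructions. -/
def Prog.writes : Prog → List Loc
  | skip => []
  | op o => [o.target]
  | seq c₁ c₂ | ite _ c₁ c₂ => c₁.writes ++ c₂.writes
  | loop _ c => c.writes

/-- The memory `s'` has the same contents as `s` outside the locations in `W`. -/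
structure Store.EqOff (W : List Loc) (s' s : Store) : Prop where
  nat : ∀ x, .nat x ∉ W → s'.nat x = s.nat x
  arr : ∀ a, .arr a ∉ W → s'.arr a = s.arr a
  real : ∀ r, .real r ∉ W → s'.real r = s.real r
  rarr : ∀ a, .rarr a ∉ W → s'.rarr a = s.rarr a

section Frame

variable {D : ℕ → ℕ → ℕ} {V W : List Loc} {s s' s'' : Store}

theorem Store.EqOff.refl (W : List Loc) (s : Store) : s.EqOff W s :=
  ⟨fun _ _ => rfl, fun _ _ => rfl, fun _ _ => rfl, fun _ _ => rfl⟩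

theorem Store.EqOff.mono (h : s'.EqOff V s) (hVW : V ⊆ W) : s'.EqOff W s :=
  ⟨fun x hx => h.nat x fun hV => hx (hVW hV), fun a ha => h.arr a fun hV => ha (hVW hV),
    fun r hr => h.real r fun hV => hr (hVW hV), fun a ha => h.rarr a fun hV => ha (hVW hV)⟩

theorem Store.EqOff.trans (h' : s''.EqOff W s') (h : s'.EqOff W s) : s''.EqOff W s :=
  ⟨fun x hx => (h'.nat x hx).trans (h.nat x hx), fun a ha => (h'.arr a ha).trans (h.arr a ha),
    fun r hr => (h'.real r hr).trans (h.real r hr),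
    fun a ha => (h'.rarr a ha).trans (h.rarr a ha)⟩

theorem Op.apply_eqOff (o : Op) (s : Store) : (o.apply D s).EqOff [o.target] s := by
  cases o <;> constructor <;> intro x hx <;>
    simp_all [Op.apply, Op.target, Function.update_of_ne]

theorem Run.eqOff {c : Prog} {t : ℕ} (h : Run D c s t s') : s'.EqOff c.writes s := by
  induction h with
  | skip s => exact .refl _ s
  | op o s => exact o.apply_eqOff s
  | seq _ _ ih₁ ih₂ =>
    exact (ih₂.mono (List.subset_append_right ..)).trans (ih₁.mono (List.subset_append_left ..))
  | ite_true _ _ ih => exact ih.mono (List.subset_append_left ..)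
  | ite_false _ _ ih => exact ih.mono (List.subset_append_right ..)
  | loop_true _ _ _ ih₁ ih₂ => exact ih₂.trans ih₁
  | loop_false => exact .refl ..

end Frame

/-- The total-correctness judgement with a time bound: `c`, started in `s`, halts within `N` steps
in a memory that satisfies `Q`. -/
def Halts (D : ℕ → ℕ → ℕ) (c : Prog) (s : Store) (N : ℕ) (Q : Store → Prop) : Prop :=
  ∃ t s', Run D c s t s' ∧ t ≤ N ∧ Q s'

local infixr:60 " ;; " => Prog.seq

/-- Straight-line code. -/
def block : List Op → Prog
  | [] => .skip
  | o :: l => .op o ;; block l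

section Rules

variable {D : ℕ → ℕ → ℕ} {b : Test} {c c₁ c₂ : Prog} {s : Store} {N N₁ N₂ : ℕ}
  {Q R : Store → Prop}

theorem Halts.mono (h : Halts D c s N₁ Q) (hN : N₁ ≤ N₂)
    (hQ : ∀ s', s'.EqOff c.writes s → Q s' → R s') : Halts D c s N₂ R :=
  let ⟨t, s', hrun, ht, hs'⟩ := h
  ⟨t, s', hrun, ht.trans hN, hQ s' hrun.eqOff hs'⟩

theorem Halts.of_le (h : Halts D c s N₁ Q) (hN : N₁ ≤ N₂) : Halts D c s N₂ Q :=
  h.mono hN fun _ _ hs' => hs'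

theorem Halts.skip (h : Q s) : Halts D .skip s 1 Q := ⟨1, s, .skip s, le_rfl, h⟩

theorem Halts.op {o : Op} (h : Q (o.apply D s)) : Halts D (.op o) s 1 Q :=
  ⟨1, _, .op o s, le_rfl, h⟩

theorem Halts.seq (h₁ : Halts D c₁ s N₁ R)
    (h₂ : ∀ s', s'.EqOff c₁.writes s → R s' → Halts D c₂ s' N₂ Q) :
    Halts D (c₁ ;; c₂) s (N₁ + N₂) Q := by
  obtain ⟨t₁, s₁, hrun₁, ht₁, hs₁⟩ := h₁
  obtain ⟨t₂, s₂, hrun₂, ht₂, hs₂⟩ := h₂ s₁ hrun₁.eqOff hs₁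
  exact ⟨t₁ + t₂, s₂, .seq hrun₁ hrun₂, add_le_add ht₁ ht₂, hs₂⟩

theorem Halts.op_seq {o : Op} (h : Halts D c (o.apply D s) N Q) :
    Halts D (.op o ;; c) s (N + 1) Q := by
  obtain ⟨t, s', hrun, ht, hs'⟩ := h
  exact ⟨1 + t, s', .seq (.op o s) hrun, by omega, hs'⟩

theorem Halts.block {l : List Op} (h : Q (l.foldl (fun s o => o.apply D s) s)) :
    Halts D (block l) s (l.length + 1) Q := by
  induction l generalizing s with
  | nil => exact .skip h
  | cons o l ih => exact .op_seq (ih h)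

theorem Halts.ite (h₁ : b.Holds s → Halts D c₁ s N Q) (h₂ : ¬ b.Holds s → Halts D c₂ s N Q) :
    Halts D (.ite b c₁ c₂) s (N + 1) Q := by
  by_cases hb : b.Holds s
  · obtain ⟨t, s', hrun, ht, hs'⟩ := h₁ hb
    exact ⟨t + 1, s', .ite_true hb hrun, by omega, hs'⟩
  · obtain ⟨t, s', hrun, ht, hs'⟩ := h₂ hb
    exact ⟨t + 1, s', .ite_false hb hrun, by omega, hs'⟩

theorem Halts.loop_of_holds (hb : b.Holds s) (h : Halts D c s N₁ R)
    (h' : ∀ s', R s' → Halts D (.loop b c) s' N₂ Q) : Halts D (.loop b c) s (N₁ + N₂ + 1) Q := by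
  obtain ⟨t₁, s₁, hrun₁, ht₁, hs₁⟩ := h
  obtain ⟨t₂, s₂, hrun₂, ht₂, hs₂⟩ := h' s₁ hs₁
  exact ⟨t₁ + t₂ + 1, s₂, .loop_true hb hrun₁ hrun₂, by omega, hs₂⟩

theorem Halts.loop_of_not_holds (hb : ¬ b.Holds s) (h : Q s) : Halts D (.loop b c) s 1 Q :=
  ⟨1, s, .loop_false hb, le_rfl, h⟩

theorem Halts.loop_natLt {x y m : ℕ} (I : ℕ → Store → Prop) (cost : ℕ → ℕ)
    (hI : ∀ k s, I k s → s.nat x = k ∧ s.nat y = m)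
    (hstep : ∀ k < m, ∀ s, I k s → Halts D c s (cost k) (I (k + 1))) {k : ℕ} (hk : k ≤ m)
    (hs : I k s) :
    Halts D (.loop (.natLt x y) c) s (∑ i ∈ Finset.Ico k m, (cost i + 1) + 1) (I m) := by
  induction hk using Nat.decreasingInduction generalizing s with
  | self =>
    simpa using Halts.loop_of_not_holds (by simp [Test.Holds, hI _ _ hs]) hs
  | of_succ k hk ih =>
    refine (Halts.loop_of_holds ?_ (hstep k hk s hs) fun s' => ih).of_le ?_
    · simpa [Test.Holds, hI _ _ hs] using hk
    · rw [Finset.sum_eq_sum_Ico_succ_bot hk]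
      omega

end Rules

/-! ### The program -/

-- Up to `entry'` these are registers for natural numbers (the first three hold the input), up to
-- `weight` registers for real numbers (the first one holds the threshold); then come the arrays of
-- natural numbers (`current` is the output) and the arrays of real numbers.
namespace Reg
@[simp] abbrev nodes : ℕ := 0
@[simp] abbrev samples : ℕ := 1
@[simp] abbrev target : ℕ := 2
@[simp] abbrev zero : ℕ := 3
@[simp] abbrev one : ℕ := 4
@[simp] abbrev active : ℕ := 5
@[simp] abbrev cand : ℕ := 6
@[simp] abbrev best : ℕ := 7
@[simp] abbrev mark : ℕ := 8
@[simp] abbrev col : ℕ := 9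
@[simp] abbrev row : ℕ := 10
@[simp] abbrev code : ℕ := 11
@[simp] abbrev entry : ℕ := 12
@[simp] abbrev entry' : ℕ := 13

@[simp] abbrev threshold : ℕ := 0
@[simp] abbrev maxInfl : ℕ := 1
@[simp] abbrev infl : ℕ := 2
@[simp] abbrev rzero : ℕ := 3
@[simp] abbrev rone : ℕ := 4
@[simp] abbrev xi : ℕ := 5
@[simp] abbrev xu : ℕ := 6
@[simp] abbrev acc : ℕ := 7
@[simp] abbrev nPlus : ℕ := 8
@[simp] abbrev nMinus : ℕ := 9
@[simp] abbrev qPlus : ℕ := 10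
@[simp] abbrev qMinus : ℕ := 11
@[simp] abbrev total : ℕ := 12
@[simp] abbrev nu : ℕ := 13
@[simp] abbrev weight : ℕ := 14

@[simp] abbrev current : ℕ := 0
@[simp] abbrev codes : ℕ := 1

@[simp] abbrev plus : ℕ := 0
@[simp] abbrev minus : ℕ := 1
@[simp] abbrev plusTarget : ℕ := 2
@[simp] abbrev minusTarget : ℕ := 3

end Reg

open Reg

/-- Runs `c` with `nat[x] = 0, 1, …, nat[y] - 1`; the constant `1` is read from the register
`one`. -/
def forLoop (x y : ℕ) (c : Prog) : Prog :=
  .op (.const x 0) ;; .loop (.natLt x y) (c ;; .op (.add x x one))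

theorem Halts.forLoop_of_step {D : ℕ → ℕ → ℕ} {c : Prog} {s : Store} {x y m : ℕ}
    (hx : .nat x ∉ c.writes) (hy : .nat y ∉ (forLoop x y c).writes)
    (hone : .nat one ∉ (forLoop x y c).writes) (hsy : s.nat y = m) (hs1 : s.nat one = 1)
    (I : ℕ → Store → Prop) (cost : ℕ → ℕ) (hzero : I 0 ((Op.const x 0).apply D s))
    (hstep : ∀ k < m, ∀ s', s'.EqOff (forLoop x y c).writes s → s'.nat x = k → I k s' →
      Halts D c s' (cost k) fun s'' => I (k + 1) ((Op.add x x one).apply D s'')) :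
    Halts D (forLoop x y c) s (∑ k ∈ Finset.range m, (cost k + 2) + 2) (I m) := by
  have hcW : (c ;; .op (.add x x one)).writes ⊆ (forLoop x y c).writes :=
    List.subset_append_right ..
  rw [Finset.range_eq_Ico]
  refine .op_seq ((Halts.loop_natLt
    (fun k s' => (s'.nat x = k ∧ s'.nat y = m) ∧ s'.EqOff (forLoop x y c).writes s ∧
      I k s') (fun k => cost k + 1) (fun k s' h => h.1) ?_ m.zero_le ?_).mono le_rfl
    fun _ _ h => h.2.2)
  · rintro k hk s' ⟨⟨hsx, -⟩, hE, hI⟩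
    have hbody : Halts D (c ;; .op (.add x x one)) s' (cost k + 1) fun s'' =>
        s''.nat x = k + 1 ∧ I (k + 1) s'' := by
      refine .seq (hstep k hk s' hE hsx hI) fun s'' hE' hI' => .op ⟨?_, hI'⟩
      have h1 : s''.nat one = 1 := by
        rw [hE'.nat one fun h => hone (hcW (List.subset_append_left _ _ h)), hE.nat one hone, hs1]
      simp [Op.apply, h1, hE'.nat x hx, hsx]
    refine hbody.mono le_rfl fun s'' hE' hs'' => ?_
    have hE'' := (hE'.mono hcW).trans hE
    exact ⟨⟨hs''.1, (hE''.nat y hy).trans hsy⟩, hE'', hs''.2⟩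
  · have hE : ((Op.const x 0).apply D s).EqOff (forLoop x y c).writes s :=
      (Op.apply_eqOff _ s).mono (List.subset_append_left ..)
    exact ⟨⟨by simp [Op.apply], (hE.nat y hy).trans hsy⟩, hE, hzero⟩

theorem Halts.forLoop_const {D : ℕ → ℕ → ℕ} {c : Prog} {s : Store} {x y m : ℕ}
    (hx : .nat x ∉ c.writes) (hy : .nat y ∉ (forLoop x y c).writes)
    (hone : .nat one ∉ (forLoop x y c).writes) (hsy : s.nat y = m) (hs1 : s.nat one = 1)
    (I : ℕ → Store → Prop) (C : ℕ) (hzero : I 0 ((Op.const x 0).apply D s))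
    (hstep : ∀ k < m, ∀ s', s'.EqOff (forLoop x y c).writes s → s'.nat x = k → I k s' →
      Halts D c s' C fun s'' => I (k + 1) ((Op.add x x one).apply D s'')) :
    Halts D (forLoop x y c) s (m * (C + 2) + 2) (I m) := by
  simpa using Halts.forLoop_of_step hx hy hone hsy hs1 I (fun _ => C) hzero hstep

/-- Given the codes of the restrictions of the samples to the marked columns below `col`, computes
the codes for the columns up to `col`. -/
def codeStep : Prog :=
  .op (.load mark current col) ;;
  .ite (.natEq mark one)
    (forLoop row samples (block [.load code codes row, .input entry row col, .add code code code,
      .add code code entry, .store codes row code]))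
    .skip

/-- Computes in the array `codes` the codes of the restrictions of the samples to the current
set. -/
def codeProg : Prog :=
  forLoop row samples (.op (.store codes row zero)) ;; forLoop col nodes codeStep

/-- Sets the counters of all occurring codes to `0`. -/
def clearProg : Prog :=
  forLoop row samples (block [.load code codes row, .rstore plus code rzero,
    .rstore minus code rzero, .rstore plusTarget code rzero, .rstore minusTarget code rzero])

/-- Adds the real register `v` to the counter of the current code in the array `a`. -/
def bump (a v : ℕ) : List Op := [.rload acc a code, .radd acc acc v, .rstore a code acc]

/-- Counts, for each code, the samples by the spin at the candidate, and among these the samples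
with spin `+` at the target. -/
def tallyProg : Prog :=
  forLoop row samples (block ([.load code codes row, .input entry row cand,
    .input entry' row target, .cast rone one, .cast xi entry, .cast xu entry'] ++ bump plus xi ++
    [.rmul nu xi xu] ++ bump plusTarget nu ++ [.rsub xi rone xi] ++ bump minus xi ++
    [.rmul nu xi xu] ++ bump minusTarget nu))

/-- Adds the contribution of the sample `row` to the influence. -/
def sumStep : Prog :=
  block [.load code codes row, .rload nPlus plus code, .rload nMinus minus code,
    .rload qPlus plusTarget code, .rload qMinus minusTarget code, .radd total nPlus nMinus,
    .rdiv qPlus qPlus nPlus, .rdiv qMinus qMinus nMinus, .rsub nu qPlus qMinus,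
    .rdiv nPlus nPlus total, .rdiv nMinus nMinus total, .radd weight nPlus nPlus,
    .rmul weight weight nMinus] ;;
  .ite (.realLt nu rzero) (.op (.rsub nu rzero nu)) .skip ;;
  block [.rmul weight weight nu, .radd infl infl weight]

/-- Computes the influence of the candidate from the counters. -/
def sumProg : Prog :=
  .op (.radd infl rzero rzero) ;; forLoop row samples sumStep ;;
  block [.cast total samples, .rdiv infl infl total]

/-- Computes the influence of the candidate given the current set. -/
def inflProg : Prog := clearProg ;; tallyProg ;; sumProg

/-- Compares the influence of the candidate with the largest influence found so far. -/
def updateMax : Prog :=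
  .op (.load mark current cand) ;;
  .ite (.natEq mark zero)
    (.ite (.natEq cand target) .skip
      (.ite (.realLt maxInfl infl) (block [.add best cand zero, .radd maxInfl infl rzero]) .skip))
    .skip

/-- Finds a node of maximal influence. -/
def argmaxProg : Prog :=
  .op (.radd maxInfl rzero rzero) ;; forLoop cand nodes (inflProg ;; updateMax)

/-- One round of the greedy phase; the last round clears the flag `active`. -/
def greedyStep : Prog :=
  codeProg ;; argmaxProg ;;
  .ite (.realLt maxInfl threshold) (.op (.const active 0)) (.op (.store current best one))

/-- The greedy phase. -/
def greedyProg : Prog := .loop (.natEq active one) greedyStep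

/-- The pruning step for the candidate: removes it from the current set, and puts it back if its
influence given the remaining set reaches the threshold. -/
def pruneNode : Prog :=
  .op (.store current cand zero) ;; codeProg ;; inflProg ;;
  .ite (.realLt infl threshold) .skip (.op (.store current cand one))

/-- The pruning phase. -/
def pruneProg : Prog :=
  forLoop cand nodes (.op (.load mark current cand) ;; .ite (.natEq mark one) pruneNode .skip)

/-- The program that implements the algorithm. -/
def learnProg : Prog := block [.const one 1, .const active 1] ;; greedyProg ;; pruneProg

/-- The input and the constants are in their registers. -/
structure Env (p n u : ℕ) (τ : ℝ) (s : Store) : Prop where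
  nodes_eq : s.nat nodes = p
  samples_eq : s.nat samples = n
  target_eq : s.nat target = u
  zero_eq : s.nat zero = 0
  one_eq : s.nat one = 1
  threshold_eq : s.real threshold = τ
  rzero_eq : s.real rzero = 0

theorem Env.of_eqOff {p n u : ℕ} {τ : ℝ} {s s' : Store} {W : List Loc} (h : Env p n u τ s)
    (hE : s'.EqOff W s)
    (hW : ∀ l ∈ [Loc.nat nodes, .nat samples, .nat target, .nat zero, .nat one,
      .real threshold, .real rzero], l ∉ W) : Env p n u τ s' := by
  simp only [List.forall_mem_cons] at hW
  obtain ⟨h0, h1, h2, h3, h4, h5, h6, -⟩ := hW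
  exact ⟨(hE.nat _ h0).trans h.nodes_eq, (hE.nat _ h1).trans h.samples_eq,
    (hE.nat _ h2).trans h.target_eq, (hE.nat _ h3).trans h.zero_eq, (hE.nat _ h4).trans h.one_eq,
    (hE.real _ h5).trans h.threshold_eq, (hE.real _ h6).trans h.rzero_eq⟩

/-! ### Codes of restricted samples -/

/-- The binary code of the entries of row `t` in those of the first `k` columns that are marked
in `a`. -/
def rowCode (D : ℕ → ℕ → ℕ) (a : ℕ → ℕ) (t : ℕ) : ℕ → ℕ
  | 0 => 0
  | k + 1 => if a k = 1 then rowCode D a t k + rowCode D a t k + D t k else rowCode D a t k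

theorem rowCode_inj {D : ℕ → ℕ → ℕ} (hD : ∀ t j, D t j ≤ 1) (a : ℕ → ℕ) (t t' k : ℕ) :
    rowCode D a t k = rowCode D a t' k ↔ ∀ j < k, a j = 1 → D t j = D t' j := by
  induction k with
  | zero => simp [rowCode]
  | succ k ih =>
    have h1 := hD t k
    have h2 := hD t' k
    simp only [rowCode, Nat.forall_lt_succ_right]
    split_ifs with h
    · rw [← ih]
      simp only [h, true_implies]
      omega
    · simp [ih, h]

section Specs

variable {D : ℕ → ℕ → ℕ} {p n u k : ℕ} {τ : ℝ} {s : Store}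

theorem codeStep_spec (hs : Env p n u τ s) (hcol : s.nat col = k)
    (hcodes : ∀ t < n, s.arr codes t = rowCode D (s.arr current) t k) :
    Halts D codeStep s (8 * (n + 1)) fun s' =>
      ∀ t < n, s'.arr codes t = rowCode D (s.arr current) t (k + 1) := by
  refine (Halts.op_seq (Halts.ite (N := n * (6 + 2) + 2) (fun hmark => ?_) fun hmark => ?_)).of_le
    (by omega)
  · replace hmark : s.arr current k = 1 := by
      simpa [Test.Holds, Op.apply, hcol, hs.one_eq] using hmark
    refine (Halts.forLoop_const (m := n) (by decide) (by decide) (by decide)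
      (by simp [Op.apply, hs.samples_eq]) (by simp [Op.apply, hs.one_eq])
      (fun m s' => ∀ t < n, s'.arr codes t =
        rowCode D (s.arr current) t (if t < m then k + 1 else k)) 6 ?_ ?_).mono le_rfl
      fun s' _ h t ht => by simpa [ht] using h t ht
    · simpa [Op.apply] using hcodes
    · intro m hm s' hE hrow hI
      refine .block fun t ht => ?_
      have hcol' : s'.nat col = k := (hE.nat col (by decide)).trans (by simpa [Op.apply] using hcol)
      have hm' := hI m hm
      by_cases htm : t = m
      · subst htm
        simp_all [Op.apply, rowCode]
      · have hlt : t < m + 1 ↔ t < m := by omega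
        simp [Op.apply, hrow, htm, hlt, hI t ht]
  · replace hmark : s.arr current k ≠ 1 := by
      simpa [Test.Holds, Op.apply, hcol, hs.one_eq] using hmark
    refine (Halts.skip fun t ht => ?_).of_le (by omega)
    simp [Op.apply, rowCode, hmark, hcodes t ht]

theorem codeProg_spec (hs : Env p n u τ s) :
    Halts D codeProg s (10 * ((p + 1) * (n + 1))) fun s' =>
      ∀ t < n, s'.arr codes t = rowCode D (s'.arr current) t p := by
  have hclear : Halts D (forLoop row samples (.op (.store codes row zero))) s (n * (1 + 2) + 2)
      fun s' => ∀ t < n, s'.arr codes t = 0 := by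
    refine Halts.forLoop_const (by decide) (by decide) (by decide) hs.samples_eq hs.one_eq
      (fun k s' => ∀ t < k, s'.arr codes t = 0) 1 (by simp) fun k hk s' hE hrow hI => .op ?_
    intro t ht
    rcases Nat.lt_succ_iff_lt_or_eq.1 ht with h | rfl
    · simp [Op.apply, hrow, h.ne, hI t h]
    · simp [Op.apply, hrow, (hs.of_eqOff hE (by decide)).zero_eq]
  refine (hclear.seq fun s₁ hE₁ hzero => ?_).of_le (N₂ := 10 * ((p + 1) * (n + 1)))
    (N₁ := n * (1 + 2) + 2 + (p * (8 * (n + 1) + 2) + 2)) (by ring_nf; omega)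
  have hs₁ := hs.of_eqOff hE₁ (by decide)
  refine Halts.forLoop_const (by decide) (by decide) (by decide) hs₁.nodes_eq hs₁.one_eq
    (fun k s' => ∀ t < n, s'.arr codes t = rowCode D (s'.arr current) t k) _
    (by simpa [Op.apply, rowCode] using hzero) fun k _ s₂ hE₂ hcol hI => ?_
  refine (codeStep_spec (hs₁.of_eqOff hE₂ (by decide)) hcol hI).mono le_rfl fun s₃ hE₃ h t ht => ?_
  simpa [Op.apply, hE₃.arr current (by decide)] using h t ht

end Specs

/-! ### Influences from counters -/

/-- The sum of `f` over the first `m` rows with code `c`. -/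
noncomputable def codeSum (code : ℕ → ℕ) (f : ℕ → ℝ) (m c : ℕ) : ℝ :=
  ∑ t ∈ Finset.range m, if code t = c then f t else 0

theorem codeSum_succ (code : ℕ → ℕ) (f : ℕ → ℝ) (m c : ℕ) :
    codeSum code f (m + 1) c = codeSum code f m c + if code m = c then f m else 0 :=
  Finset.sum_range_succ ..

/-- After `m` rows, the four counters of the code `c` hold the numbers of rows with entry `1` and
with entry `0` in column `i`, and of such rows with entry `1` in column `u`. -/
structure Tally (D : ℕ → ℕ → ℕ) (u i : ℕ) (code : ℕ → ℕ) (m : ℕ) (r : ℕ → ℕ → ℝ) (c : ℕ) :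
    Prop where
  plus_eq : r plus c = codeSum code (fun t => D t i) m c
  minus_eq : r minus c = codeSum code (fun t => 1 - D t i) m c
  plusTarget_eq : r plusTarget c = codeSum code (fun t => D t i * D t u) m c
  minusTarget_eq : r minusTarget c = codeSum code (fun t => (1 - D t i) * D t u) m c

/-- The contribution of a row with code `c` to the influence of column `i` on column `u`. -/
noncomputable def rowTerm (D : ℕ → ℕ → ℕ) (code : ℕ → ℕ) (n u i c : ℕ) : ℝ :=
  let P := codeSum code (fun t => D t i) n c
  let M := codeSum code (fun t => 1 - D t i) n c
  2 * (P / (P + M)) * (M / (P + M)) * |codeSum code (fun t => D t i * D t u) n c / P -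
    codeSum code (fun t => (1 - D t i) * D t u) n c / M|

section Specs

variable {D : ℕ → ℕ → ℕ} {p n u i : ℕ} {τ : ℝ} {s : Store}

theorem clearProg_spec (hs : Env p n u τ s) :
    Halts D clearProg s (n * (6 + 2) + 2) fun s' =>
      ∀ t < n, Tally D u i (s'.arr codes) 0 s'.rarr (s'.arr codes t) := by
  refine (Halts.forLoop_const (by decide) (by decide) (by decide) hs.samples_eq hs.one_eq
    (fun k s' => ∀ t < k, ∀ a < 4, s'.rarr a (s'.arr codes t) = 0) 6 (by simp)
    fun k _ s' hE hrow hI => .block ?_).mono le_rfl fun s' _ h t ht => ?_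
  · have hz := (hs.of_eqOff hE (by decide)).rzero_eq
    intro t ht a ha
    by_cases hc : s'.arr codes t = s'.arr codes k
    · interval_cases a <;> simp_all [Op.apply]
    · have htk : t < k := lt_of_le_of_ne (Nat.lt_succ_iff.1 ht) fun h => hc (h ▸ rfl)
      have := hI t htk a ha
      interval_cases a <;> simp_all [Op.apply]
  · constructor <;> simp [codeSum, h t ht]

theorem tallyProg_spec (hs : Env p n u τ s) (hi : s.nat cand = i)
    (h0 : ∀ t < n, Tally D u i (s.arr codes) 0 s.rarr (s.arr codes t)) :
    Halts D tallyProg s (n * (22 + 2) + 2) fun s' =>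
      ∀ t < n, Tally D u i (s'.arr codes) n s'.rarr (s'.arr codes t) := by
  refine Halts.forLoop_const (by decide) (by decide) (by decide) hs.samples_eq hs.one_eq
    (fun k s' => ∀ t < n, Tally D u i (s'.arr codes) k s'.rarr (s'.arr codes t)) 22
    (by simpa [Op.apply] using h0) fun k _ s' hE hrow hI => .block fun t ht => ?_
  have hu := (hs.of_eqOff hE (by decide)).target_eq
  have h1 := (hs.of_eqOff hE (by decide)).one_eq
  have hi' : s'.nat cand = i := (hE.nat cand (by decide)).trans hi
  obtain ⟨hp, hm, hpt, hmt⟩ := hI t ht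
  by_cases hc : s'.arr codes k = s'.arr codes t
  · constructor <;>
      simp [bump, Op.apply, codeSum_succ, hrow, hu, h1, hi', hc, hp, hm, hpt, hmt]
  · constructor <;>
      simp [bump, Op.apply, codeSum_succ, hrow, Ne.symm hc, hc, hp, hm, hpt, hmt]

theorem sumStep_spec (hz : s.real rzero = 0)
    (hT : Tally D u i (s.arr codes) n s.rarr (s.arr codes (s.nat row))) :
    Halts D sumStep s 19 fun s' =>
      s'.real infl = s.real infl + rowTerm D (s.arr codes) n u i (s.arr codes (s.nat row)) := by
  obtain ⟨hp, hm, hpt, hmt⟩ := hT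
  set c := s.arr codes (s.nat row) with hc
  set P := codeSum (s.arr codes) (fun t => D t i) n c with hP
  set M := codeSum (s.arr codes) (fun t => 1 - D t i) n c with hM
  set ν := codeSum (s.arr codes) (fun t => D t i * D t u) n c / P -
    codeSum (s.arr codes) (fun t => (1 - D t i) * D t u) n c / M with hν
  refine (Halts.seq (N₁ := 14) (N₂ := 5) (R := fun s' => s'.real infl = s.real infl ∧
    s'.real weight = 2 * (P / (P + M)) * (M / (P + M)) ∧ s'.real nu = ν ∧ s'.real rzero = 0)
    (.block ?_) fun s₁ _ ⟨hinfl, hw, hnu, hz₁⟩ => ?_)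
  · simp [Op.apply, ← hc, hp, hm, hpt, hmt, hz, hν, two_mul]
  refine Halts.seq (N₁ := 2) (N₂ := 3) (R := fun s' => s'.real infl = s.real infl ∧
    s'.real weight = 2 * (P / (P + M)) * (M / (P + M)) ∧ s'.real nu = |ν|)
    (.ite (fun hneg => .op ?_) fun hneg => .skip ?_) fun s₂ _ ⟨hinfl, hw, hnu⟩ => .block ?_
  · simp only [Test.Holds, hnu, hz₁] at hneg
    simp [Op.apply, hinfl, hw, hnu, hz₁, abs_of_neg hneg]
  · simp only [Test.Holds, hnu, hz₁, not_lt] at hneg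
    exact ⟨hinfl, hw, hnu.trans (abs_of_nonneg hneg).symm⟩
  · simp [Op.apply, hinfl, hw, hnu, rowTerm, ← hP, ← hM, hν]

theorem sumProg_spec (hs : Env p n u τ s)
    (hT : ∀ t < n, Tally D u i (s.arr codes) n s.rarr (s.arr codes t)) :
    Halts D sumProg s (n * (19 + 2) + 6) fun s' =>
      s'.real infl =
        (∑ t ∈ Finset.range n, rowTerm D (s.arr codes) n u i (s.arr codes t)) / n := by
  set s₀ := (Op.radd infl rzero rzero).apply D s with hs₀
  have hE₀ : s₀.EqOff [.real infl] s :=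
    Op.apply_eqOff (.radd infl rzero rzero) s
  have hs' := hs.of_eqOff hE₀ (by decide)
  refine Halts.op_seq (Halts.seq (N₁ := n * (19 + 2) + 2) (N₂ := 3) (R := fun s' =>
    s'.real infl = ∑ t ∈ Finset.range n, rowTerm D (s.arr codes) n u i (s.arr codes t))
    ?_ fun s₂ hE₂ hI => ?_)
  · refine Halts.forLoop_const (by decide) (by decide) (by decide) hs'.samples_eq hs'.one_eq
      (fun k s' => s'.real infl =
        ∑ t ∈ Finset.range k, rowTerm D (s.arr codes) n u i (s.arr codes t)) 19
      (by simp [Op.apply, hs₀, hs.rzero_eq]) fun k hk s₁ hE₁ hrow hI => ?_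
    have harr : s₁.arr codes = s.arr codes := hE₁.arr codes (by decide)
    refine (sumStep_spec (D := D) (u := u) (i := i) (n := n)
      (hs'.of_eqOff hE₁ (by decide)).rzero_eq ?_).mono le_rfl fun s₂ _ h => ?_
    · have hr : s₁.rarr = s.rarr := funext fun a =>
        hE₁.rarr a (by simp [forLoop, sumStep, block, Prog.writes, Op.target])
      rw [harr, hrow, hr]
      exact hT k hk
    · rw [Finset.sum_range_succ, ← hI, ← harr, ← hrow, ← h]
      rfl
  · have hn := (hs'.of_eqOff hE₂ (by decide)).samples_eq
    exact .block (by simp [Op.apply, hI, hn])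

theorem inflProg_spec (hs : Env p n u τ s) (hi : s.nat cand = i) :
    Halts D inflProg s (53 * (n + 1)) fun s' => s'.real infl =
      (∑ t ∈ Finset.range n, rowTerm D (s.arr codes) n u i (s.arr codes t)) / n := by
  refine (Halts.seq (clearProg_spec (i := i) hs) fun s₁ hE₁ h₁ => Halts.seq
    (tallyProg_spec (hs.of_eqOff hE₁ (by decide)) ((hE₁.nat cand (by decide)).trans hi) h₁)
    fun s₂ hE₂ h₂ => (sumProg_spec ((hs.of_eqOff hE₁ (by decide)).of_eqOff hE₂ (by decide))
      h₂).mono le_rfl fun s₃ _ h₃ => ?_).of_le (by omega)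
  rwa [← hE₁.arr codes (by decide), ← hE₂.arr codes (by decide)]

end Specs

/-- The first `p` cells of `a` hold the indicator function of `S`. -/
def Marks {p : ℕ} (a : ℕ → ℕ) (S : Finset (Fin p)) : Prop :=
  ∀ j : Fin p, a j = if j ∈ S then 1 else 0

section Link

variable {p n : ℕ} {X : Samples p n} {S : Finset (Fin p)} {a code : ℕ → ℕ}

theorem inputMatrix_fin (X : Samples p n) (t : Fin n) (i : Fin p) :
    inputMatrix X t i = if X t i then 1 else 0 := by
  simp [inputMatrix]

theorem inputMatrix_le_one (X : Samples p n) (t i : ℕ) : inputMatrix X t i ≤ 1 := by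
  unfold inputMatrix
  split_ifs <;> simp

theorem rowCode_eq_iff_mem_agreeEvent (ha : Marks a S) (t t' : Fin n) :
    rowCode (inputMatrix X) a t p = rowCode (inputMatrix X) a t' p ↔
      X t ∈ agreeEvent S (X t') := by
  rw [rowCode_inj (inputMatrix_le_one X)]
  constructor
  · intro h j hj
    have := h j j.2 (by simp [ha j, hj])
    rw [inputMatrix_fin, inputMatrix_fin] at this
    revert this
    cases X t j <;> cases X t' j <;> simp
  · intro h j hj haj
    lift j to Fin p using hj
    rw [ha j] at haj
    rw [inputMatrix_fin, inputMatrix_fin, h j (by by_contra hc; simp [hc] at haj)]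

theorem codeSum_eq_empProb (ha : Marks a S)
    (hcode : ∀ t < n, code t = rowCode (inputMatrix X) a t p) {f : ℕ → ℝ} {A : Set (Config p)}
    (hf : ∀ t : Fin n, f t = A.indicator 1 (X t)) (t : Fin n) :
    codeSum code f n (code t) = n * empProb X (A ∩ agreeEvent S (X t)) := by
  have hn : (n : ℝ) ≠ 0 := by exact_mod_cast (Fin.pos t).ne'
  unfold codeSum empProb empMean
  rw [← mul_assoc, mul_one_div_cancel hn, one_mul, Finset.sum_range]
  refine Finset.sum_congr rfl fun t' _ => ?_
  classical
  rw [Set.inter_comm, ← Set.indicator_indicator, Set.indicator_apply, hcode _ t'.2, hcode _ t.2,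
    hf]
  simp only [rowCode_eq_iff_mem_agreeEvent ha]

theorem empProb_spinEvent_add (X : Samples p n) (i : Fin p) (B : Set (Config p)) :
    empProb X (spinEvent i true ∩ B) + empProb X (spinEvent i false ∩ B) = empProb X B := by
  unfold empProb empMean
  rw [← mul_add, ← Finset.sum_add_distrib]
  congr 2 with t
  by_cases hB : X t ∈ B <;> cases h : X t i <;> simp [spinEvent, hB, h]

theorem sum_rowTerm (ha : Marks a S) (hcode : ∀ t < n, code t = rowCode (inputMatrix X) a t p)
    (u i : Fin p) :
    (∑ t ∈ Finset.range n, rowTerm (inputMatrix X) code n u i (code t)) / n =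
      empMean X fun x => empWeight X i S x * |empNu X u i S x| := by
  rw [empMean, div_eq_inv_mul, one_div, Finset.sum_range]
  congr 1
  refine Finset.sum_congr rfl fun t _ => ?_
  have hn : (n : ℝ) ≠ 0 := by exact_mod_cast (Fin.pos t).ne'
  have hplus : ∀ (t : Fin n) (j : Fin p),
      (inputMatrix X t j : ℝ) = (spinEvent j true).indicator 1 (X t) := by
    intro t j
    rw [inputMatrix_fin]
    cases h : X t j <;> simp [spinEvent, h]
  have hminus : ∀ (t : Fin n) (j : Fin p),
      1 - (inputMatrix X t j : ℝ) = (spinEvent j false).indicator 1 (X t) := by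
    intro t j
    rw [inputMatrix_fin]
    cases h : X t j <;> simp [spinEvent, h]
  have hinter : ∀ A B : Set (Config p), ∀ x,
      A.indicator 1 x * B.indicator 1 x = (B ∩ A).indicator (1 : Config p → ℝ) x := by
    intro A B x
    rw [Set.inter_comm, Set.inter_indicator_one]
    rfl
  rw [rowTerm, codeSum_eq_empProb ha hcode fun t => hplus t i,
    codeSum_eq_empProb ha hcode fun t => hminus t i,
    codeSum_eq_empProb ha hcode fun t => by rw [hplus, hplus, hinter],
    codeSum_eq_empProb ha hcode fun t => by rw [hminus, hplus, hinter],
    ← mul_add, empProb_spinEvent_add]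
  simp only [mul_div_mul_left _ _ hn, empWeight, empNu, empCond, Set.inter_assoc]

end Link

/-! ### The phases of the algorithm -/

/-- The registers `best` and `maxInfl` describe a node of maximal influence among those below `k`,
where `maxInfl` starts from `0`. -/
structure MaxBelow {p n : ℕ} (X : Samples p n) (u : Fin p) (S : Finset (Fin p)) (k : ℕ)
    (s : Store) : Prop where
  le : ∀ j : Fin p, (j : ℕ) < k → empInfluence X u j S ≤ s.real maxInfl
  nonneg : 0 ≤ s.real maxInfl
  attained : s.real maxInfl = 0 ∨
    ∃ j : Fin p, s.nat best = j ∧ empInfluence X u j S = s.real maxInfl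

section Specs

variable {p n : ℕ} {X : Samples p n} {u : Fin p} {τ : ℝ} {s : Store} {S : Finset (Fin p)}

theorem MaxBelow.succ_of_le {k : Fin p} (h : MaxBelow X u S k s)
    (hk : empInfluence X u k S ≤ s.real maxInfl) : MaxBelow X u S (k + 1) s := by
  refine ⟨fun j hj => ?_, h.nonneg, h.attained⟩
  rcases Nat.lt_succ_iff_lt_or_eq.1 hj with hj | hj
  · exact h.le j hj
  · rwa [Fin.ext hj]

theorem inflProg_spec_empMean {i : Fin p} (hs : Env p n u τ s) (hi : s.nat cand = i)
    (hS : Marks (s.arr current) S)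
    (hcodes : ∀ t < n, s.arr codes t = rowCode (inputMatrix X) (s.arr current) t p) :
    Halts (inputMatrix X) inflProg s (53 * (n + 1)) fun s' =>
      s'.real infl = empMean X fun x => empWeight X i S x * |empNu X u i S x| :=
  (inflProg_spec hs hi).mono le_rfl fun _ _ h => h.trans (sum_rowTerm hS hcodes u i)

theorem updateMax_spec {k : Fin p} (hs : Env p n u τ s) (hk : s.nat cand = k)
    (hS : Marks (s.arr current) S) (hmax : MaxBelow X u S k s)
    (hinfl : s.real infl = empMean X fun x => empWeight X k S x * |empNu X u k S x|) :
    Halts (inputMatrix X) updateMax s 7 (MaxBelow X u S (k + 1)) := by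
  set s₁ := (Op.load mark current cand).apply (inputMatrix X) s with hs₁
  have hmax₁ : MaxBelow X u S k s₁ := ⟨hmax.le, hmax.nonneg, hmax.attained⟩
  have hskip (h : empInfluence X u k S ≤ s.real maxInfl) :
      Halts (inputMatrix X) .skip s₁ 1 (MaxBelow X u S (k + 1)) := .skip (hmax₁.succ_of_le h)
  have hmark : (Test.natEq mark zero).Holds s₁ ↔ k ∉ S := by
    simp [Test.Holds, hs₁, Op.apply, hk, hS k, hs.zero_eq]
  have htarget : (Test.natEq cand target).Holds s₁ ↔ k = u := by
    simp [Test.Holds, hs₁, Op.apply, hk, hs.target_eq, Fin.ext_iff]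
  have hzero (h : k ∈ insert u S) : empInfluence X u k S ≤ s.real maxInfl := by
    simpa only [empInfluence, if_pos h] using hmax.nonneg
  refine .op_seq (.ite (N := 5) (fun hb => .ite (N := 4) (fun hb' => ?_) fun hb' =>
    .ite (N := 3) (fun hb'' => .block ?_) fun hb'' => ?_) fun hb => ?_)
  · exact (hskip (hzero (by simp [htarget.1 hb']))).of_le (by norm_num)
  · have hnew : s.real infl = empInfluence X u k S := by
      rw [hinfl, empInfluence, if_neg (by simp [hmark.1 hb, mt htarget.2 hb'])]
    have hlt : s.real maxInfl < empInfluence X u k S := hnew ▸ hb''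
    set s₂ := (Op.radd maxInfl infl rzero).apply (inputMatrix X)
      ((Op.add best cand zero).apply (inputMatrix X) s₁)
    have hreal : s₂.real maxInfl = empInfluence X u k S := by
      simp [s₂, s₁, Op.apply, hs.rzero_eq, hnew]
    have hbest : s₂.nat best = k := by simp [s₂, s₁, Op.apply, hs.zero_eq, hk]
    exact MaxBelow.succ_of_le ⟨fun j hj => hreal ▸ (hmax.le j hj).trans hlt.le,
      hreal ▸ hmax.nonneg.trans hlt.le, .inr ⟨k, hbest, hreal.symm⟩⟩ hreal.ge
  · have hnew : s.real infl = empInfluence X u k S := by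
      rw [hinfl, empInfluence, if_neg (by simp [hmark.1 hb, mt htarget.2 hb'])]
    exact (hskip (hnew ▸ not_lt.1 hb'')).of_le (by norm_num)
  · exact (hskip (hzero (by simp [not_not.1 (mt hmark.2 hb)]))).of_le (by norm_num)

theorem argmaxProg_spec (hs : Env p n u τ s) (hS : Marks (s.arr current) S)
    (hcodes : ∀ t < n, s.arr codes t = rowCode (inputMatrix X) (s.arr current) t p) :
    Halts (inputMatrix X) argmaxProg s (62 * ((p + 1) * (n + 1))) (MaxBelow X u S p) := by
  set s₁ := (Op.radd maxInfl rzero rzero).apply (inputMatrix X) s with hs₁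
  have hzero : s₁.real maxInfl = 0 := by simp [hs₁, Op.apply, hs.rzero_eq]
  have hs' : Env p n u τ s₁ := hs.of_eqOff (Op.apply_eqOff (.radd ..) s) (by decide)
  refine (Halts.op_seq (Halts.forLoop_const (by decide) (by decide) (by decide) hs'.nodes_eq
    hs'.one_eq (MaxBelow X u S) (53 * (n + 1) + 7) ⟨by simp, hzero.ge, .inl hzero⟩
    fun k hk s₂ hE₂ hcand hI => ?_)).of_le (by ring_nf; omega)
  lift k to Fin p using hk
  have hS₂ : s₂.arr current = s.arr current := hE₂.arr current (by decide)
  have hs₂ := hs'.of_eqOff hE₂ (by decide)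
  refine ((inflProg_spec_empMean (X := X) (S := S) hs₂ hcand (hS₂ ▸ hS) ?_).seq
    fun s₃ hE₃ hinfl => updateMax_spec (hs₂.of_eqOff hE₃ (by decide)) ?_ ?_ ?_ hinfl).mono le_rfl
    fun s₄ _ h => ⟨h.le, h.nonneg, h.attained⟩
  · rwa [hS₂, hE₂.arr codes (by decide)]
  · rwa [hE₃.nat cand (by decide)]
  · rwa [hE₃.arr current (by decide), hS₂]
  · have hmax := hE₃.real maxInfl (by decide)
    have hbest := hE₃.nat best (by decide)
    refine ⟨?_, ?_, ?_⟩ <;> rw [hmax]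
    exacts [hI.le, hI.nonneg, hbest ▸ hI.attained]

theorem notMem_of_le_empInfluence {i : Fin p} (hτ : 0 < τ) (h : τ ≤ empInfluence X u i S) :
    i ∉ insert u S := by
  intro hi
  rw [empInfluence, if_pos hi] at h
  exact absurd h (not_le.2 hτ)

theorem GreedyReach.self_notMem (hτ : 0 < τ) (h : GreedyReach X τ u S) : u ∉ S := by
  induction h with
  | empty => simp
  | add S i _ _ h ih =>
    have := notMem_of_le_empInfluence hτ h
    simp only [Finset.mem_insert, not_or] at this ⊢
    exact ⟨fun h => this.1 h.symm, ih⟩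

theorem Marks.insert {a : ℕ → ℕ} (h : Marks a S) (j : Fin p) :
    Marks (Function.update a j 1) (insert j S) := by
  intro i
  by_cases hij : i = j
  · simp [hij]
  · simp [hij, Fin.val_inj, h i]

theorem Marks.erase {a : ℕ → ℕ} (h : Marks a S) (j : Fin p) :
    Marks (Function.update a j 0) (S.erase j) := by
  intro i
  by_cases hij : i = j
  · simp [hij]
  · simp [hij, Fin.val_inj, h i]

theorem greedyStep_spec (hτ : 0 < τ) (hs : Env p n u τ s) (hactive : s.nat active = 1)
    (hS : Marks (s.arr current) S) :
    Halts (inputMatrix X) greedyStep s (74 * ((p + 1) * (n + 1))) fun s' =>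
      ((∀ i, empInfluence X u i S < τ) ∧ s'.nat active = 0 ∧ Marks (s'.arr current) S) ∨
      ∃ j, (∀ i, empInfluence X u i S ≤ empInfluence X u j S) ∧ τ ≤ empInfluence X u j S ∧
        s'.nat active = 1 ∧ Marks (s'.arr current) (insert j S) := by
  have hpos : 0 < (p + 1) * (n + 1) := by positivity
  refine ((codeProg_spec hs).seq fun s₁ hE₁ hcodes => ?_).of_le
    (N₁ := _ + (62 * ((p + 1) * (n + 1)) + 2)) (by omega)
  have hs₁ := hs.of_eqOff hE₁ (by decide)
  have hS₁ : Marks (s₁.arr current) S := by rwa [hE₁.arr current (by decide)]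
  refine (argmaxProg_spec hs₁ hS₁ hcodes).seq fun s₂ hE₂ hmax =>
    .ite (fun hlt => .op (.inl ?_)) fun hlt => .op (.inr ?_)
  all_goals
    have hs₂ := hs₁.of_eqOff hE₂ (by decide)
    have hS₂ : Marks (s₂.arr current) S := by rwa [hE₂.arr current (by decide)]
    simp only [Test.Holds, hs₂.threshold_eq, not_lt] at hlt
  · exact ⟨fun i => (hmax.le i i.2).trans_lt hlt, by simp [Op.apply], hS₂⟩
  · obtain ⟨j, hbest, hj⟩ := hmax.attained.resolve_left (hτ.trans_le hlt).ne'
    refine ⟨j, fun i => (hmax.le i i.2).trans hj.ge, hlt.trans hj.ge, ?_, ?_⟩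
    · simpa [Op.apply, hE₂.nat active (by decide), hE₁.nat active (by decide)] using hactive
    · simpa [Op.apply, hbest, hs₂.one_eq] using hS₂.insert j

theorem greedyProg_spec (hτ : 0 < τ) (hr : GreedyReach X τ u S) (hs : Env p n u τ s)
    (hactive : s.nat active = 1) (hS : Marks (s.arr current) S) :
    ∃ m S', PseudoNbhd X τ u S' ∧ S'.card = S.card + m ∧
      Halts (inputMatrix X) greedyProg s ((m + 1) * (75 * ((p + 1) * (n + 1))) + 1) fun s' =>
        Env p n u τ s' ∧ Marks (s'.arr current) S' := by
  have hpos : 0 < (p + 1) * (n + 1) := by positivity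
  induction hd : p - S.card using Nat.strong_induction_on generalizing S s with
  | _ d ih => ?_
  have hb : (Test.natEq active one).Holds s := hactive.trans hs.one_eq.symm
  obtain ⟨t, s₁, hrun, ht, hs₁⟩ := greedyStep_spec (X := X) hτ hs hactive hS
  have hEnv : Env p n u τ s₁ := hs.of_eqOff hrun.eqOff (by decide)
  obtain ⟨hlt, hinact, hm⟩ | ⟨j, hmax, hj, hact, hm⟩ := hs₁
  · refine ⟨0, S, ⟨hr, hlt⟩, rfl, (Halts.loop_of_holds hb ⟨t, s₁, hrun, ht, rfl⟩ ?_).of_le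
      (N₁ := _ + 1 + 1) (by omega)⟩
    rintro _ rfl
    exact .loop_of_not_holds (by simp [Test.Holds, hinact, hEnv.one_eq]) ⟨hEnv, hm⟩
  · have hjS : j ∉ S := fun h => notMem_of_le_empInfluence hτ hj (Finset.mem_insert_of_mem h)
    have hcard : (insert j S).card = S.card + 1 := Finset.card_insert_of_notMem hjS
    have hcard_le : (insert j S).card ≤ p := by simpa using Finset.card_le_univ (insert j S)
    obtain ⟨m, S', hS', hm', hloop⟩ :=
      ih (p - (insert j S).card) (by omega) (.add S j hr hmax hj) hEnv hact hm rfl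
    refine ⟨m + 1, S', hS', by omega, (Halts.loop_of_holds hb ⟨t, s₁, hrun, ht, rfl⟩ ?_).of_le
      (N₁ := _ + ((m + 1) * (75 * ((p + 1) * (n + 1))) + 1) + 1)
      (by rw [add_one_mul (m + 1)]; generalize (m + 1) * _ = M; omega)⟩
    rintro _ rfl
    exact hloop

end Specs

section Prune

variable {p n : ℕ} {X : Samples p n} {u : Fin p} {τ : ℝ} {s : Store} {S T : Finset (Fin p)}

theorem mem_pruneStep_of_ne {i j : Fin p} (h : j ≠ i) : j ∈ pruneStep X τ u T i ↔ j ∈ T := by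
  unfold pruneStep
  split_ifs <;> simp [h]

theorem mem_foldl_pruneStep_of_notMem {l : List (Fin p)} {j : Fin p} (h : j ∉ l) :
    j ∈ l.foldl (pruneStep X τ u) T ↔ j ∈ T := by
  induction l generalizing T with
  | nil => rfl
  | cons i l ih =>
    rw [List.mem_cons, not_or] at h
    rw [List.foldl_cons, ih h.2, mem_pruneStep_of_ne h.1]

/-- The current set after the pruning phase, run in the natural order of the nodes, has treated the
nodes below `k`. -/
noncomputable def prunedBelow (X : Samples p n) (τ : ℝ) (u : Fin p) (S : Finset (Fin p)) (k : ℕ) :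
    Finset (Fin p) :=
  (((List.finRange p).take k).filter (· ∈ S)).foldl (pruneStep X τ u) S

theorem prunedBelow_succ (k : Fin p) :
    prunedBelow X τ u S (k + 1) =
      if k ∈ S then pruneStep X τ u (prunedBelow X τ u S k) k else prunedBelow X τ u S k := by
  have htake : (List.finRange p).take (k + 1) = (List.finRange p).take k ++ [k] := by
    rw [List.take_add_one]
    simp
  unfold prunedBelow
  rw [htake, List.filter_append, List.foldl_append]
  by_cases hk : k ∈ S <;> simp [hk]

theorem self_mem_prunedBelow_iff (k : Fin p) : k ∈ prunedBelow X τ u S k ↔ k ∈ S := by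
  refine mem_foldl_pruneStep_of_notMem fun h => ?_
  obtain ⟨m, hm, hmk⟩ := List.mem_take_iff_getElem.1 (List.mem_filter.1 h).1
  simp only [List.getElem_finRange, Fin.ext_iff, Fin.val_cast] at hmk
  omega

theorem pruneNode_spec {k : Fin p} (hs : Env p n u τ s) (hcand : s.nat cand = k) (hku : k ≠ u)
    (hkT : k ∈ T) (hT : Marks (s.arr current) T) :
    Halts (inputMatrix X) pruneNode s (66 * ((p + 1) * (n + 1))) fun s' =>
      Marks (s'.arr current) (pruneStep X τ u T k) := by
  have hcost : n + 1 ≤ (p + 1) * (n + 1) := Nat.le_mul_of_pos_left _ p.succ_pos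
  refine (Halts.op_seq ?_).of_le (N₁ := 10 * ((p + 1) * (n + 1)) + (53 * (n + 1) + 2) + 1)
    (by omega)
  set s₁ := (Op.store current cand zero).apply (inputMatrix X) s with hs₁
  have hEnv₁ : Env p n u τ s₁ := hs.of_eqOff (Op.apply_eqOff (.store ..) s) (by decide)
  have hT₁ : Marks (s₁.arr current) (T.erase k) := by
    simpa [hs₁, Op.apply, hcand, hs.zero_eq] using hT.erase k
  refine (codeProg_spec hEnv₁).seq fun s₂ hE₂ hcodes => ?_
  have hEnv₂ := hEnv₁.of_eqOff hE₂ (by decide)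
  rw [← hE₂.arr current (by decide)] at hT₁
  have hcand₂ : s₂.nat cand = k := by simp [hE₂.nat cand (by decide), hs₁, Op.apply, hcand]
  refine (inflProg_spec_empMean hEnv₂ hcand₂ hT₁ hcodes).seq fun s₃ hE₃ hinfl => ?_
  have hEnv₃ := hEnv₂.of_eqOff hE₃ (by decide)
  rw [← hE₃.arr current (by decide)] at hT₁
  have hinfl' : s₃.real infl = empInfluence X u k (T.erase k) := by
    rw [hinfl, empInfluence, if_neg (by simp [hku])]
  refine .ite (fun hb => .skip ?_) fun hb => .op ?_
  all_goals simp only [Test.Holds, hinfl', hEnv₃.threshold_eq] at hb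
  · rwa [pruneStep, if_pos hb]
  · rw [pruneStep, if_neg hb, ← Finset.insert_erase hkT]
    simpa [Op.apply, hE₃.nat cand (by decide), hcand₂, hEnv₃.one_eq] using hT₁.insert k

theorem pruneProg_spec (hu : u ∉ S) (hs : Env p n u τ s) (hS : Marks (s.arr current) S) :
    Halts (inputMatrix X) pruneProg s (5 * p + 2 + S.card * (66 * ((p + 1) * (n + 1))))
      fun s' => Marks (s'.arr current) (prunedBelow X τ u S p) := by
  set K := 66 * ((p + 1) * (n + 1))
  have hcost : ∑ k ∈ Finset.range p, ((if s.arr current k = 1 then K else 0) + 3 + 2) + 2 =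
      5 * p + 2 + S.card * K := by
    have hsum : ∑ k ∈ Finset.range p, (if s.arr current k = 1 then K else 0) = S.card * K := by
      rw [Finset.sum_range]
      simp [hS _]
    simp only [Finset.sum_add_distrib, hsum, Finset.sum_const, Finset.card_range, smul_eq_mul]
    omega
  refine hcost ▸ Halts.forLoop_of_step (by decide) (by decide) (by decide) hs.nodes_eq hs.one_eq
    (fun k s' => Marks (s'.arr current) (prunedBelow X τ u S k))
    (fun k => (if s.arr current k = 1 then K else 0) + 3) ?_ fun k hk s₁ hE₁ hcand hm => ?_
  · simpa [Op.apply, prunedBelow] using hS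
  lift k to Fin p using hk
  have hs₁ := hs.of_eqOff hE₁ (by decide)
  set s₂ := (Op.load mark current cand).apply (inputMatrix X) s₁ with hs₂
  have hmark : (Test.natEq mark one).Holds s₂ ↔ k ∈ S := by
    simp [Test.Holds, hs₂, Op.apply, hcand, hm k, self_mem_prunedBelow_iff, hs₁.one_eq]
  have hEnv₂ : Env p n u τ s₂ := hs₁.of_eqOff (Op.apply_eqOff (.load ..) s₁) (by decide)
  have hm₂ : Marks (s₂.arr current) (prunedBelow X τ u S k) := hm
  refine .op_seq (N := _ + 2) (.ite (fun hb => ?_) fun hb => ?_)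
  all_goals rw [hmark] at hb
  · have hk : k ≠ u := fun h => hu (h ▸ hb)
    refine (pruneNode_spec hEnv₂ (by simp [hs₂, Op.apply, hcand]) hk
      ((self_mem_prunedBelow_iff k).2 hb) hm₂).mono ?_ fun s' _ h => ?_
    · rw [if_pos (by simp [hS k, hb])]
      omega
    · rw [prunedBelow_succ, if_pos hb]
      exact h
  · refine (Halts.skip ?_).of_le (by omega)
    rw [prunedBelow_succ, if_neg hb]
    exact hm₂

theorem learnNbhd_prunedBelow (hS : PseudoNbhd X τ u S) :
    LearnNbhd X τ u (prunedBelow X τ u S p) :=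
  ⟨S, (List.finRange p).filter (· ∈ S), hS, (List.nodup_finRange p).filter _, by ext; simp, by
    rw [prunedBelow, List.take_of_length_le (by simp)]⟩

theorem learnProg_spec (X : Samples p n) (u : Fin p) (hτ : 0 < τ) :
    ∃ t S R, PseudoNbhd X τ u S ∧ LearnNbhd X τ u R ∧ Returns learnProg X τ u t R ∧
      t ≤ 200 * ((S.card + 1) * ((p + 1) * (n + 1))) := by
  have hinit : Halts (inputMatrix X) (block [.const one 1, .const active 1]) (initStore p n τ u) 3
      fun s => Env p n u τ s ∧ s.nat active = 1 ∧ Marks (s.arr current) (∅ : Finset (Fin p)) := by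
    apply Halts.block
    refine ⟨⟨?_, ?_, ?_, ?_, ?_, ?_, ?_⟩, ?_, ?_⟩ <;> simp [Op.apply, initStore, Marks]
  obtain ⟨t₀, s₀, hrun₀, ht₀, hs₀, hactive, hm₀⟩ := hinit
  obtain ⟨m, S, hS, hm, t₁, s₁, hrun₁, ht₁, hs₁, hm₁⟩ := greedyProg_spec hτ .empty hs₀ hactive hm₀
  obtain ⟨t₂, s₂, hrun₂, ht₂, hm₂⟩ := pruneProg_spec (X := X) (hS.1.self_notMem hτ) hs₁ hm₁
  refine ⟨_, S, _, hS, learnNbhd_prunedBelow hS, ⟨s₂, .seq hrun₀ (.seq hrun₁ hrun₂), hm₂⟩, ?_⟩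
  have hp : p + 1 ≤ (p + 1) * (n + 1) := Nat.le_mul_of_pos_right _ n.succ_pos
  rw [Finset.card_empty, zero_add] at hm
  rw [← hm] at ht₁
  nlinarith

end Prune

/-! ### The size of the pseudo-neighborhood -/

section Energy

variable {p n : ℕ} {X : Samples p n} {S : Finset (Fin p)} {u i : Fin p}

/-- The event that the restriction to `S` is `y`. -/
def cylinder (S : Finset (Fin p)) (y : S → Bool) : Set (Config p) := {x | S.restrict x = y}

theorem agreeEvent_eq_cylinder (S : Finset (Fin p)) (x : Config p) :
    agreeEvent S x = cylinder S (S.restrict x) := by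
  ext y
  simp [agreeEvent, cylinder, funext_iff]

theorem agreeEvent_insert (i : Fin p) (S : Finset (Fin p)) (x : Config p) :
    agreeEvent (insert i S) x = spinEvent i (x i) ∩ cylinder S (S.restrict x) := by
  rw [← agreeEvent_eq_cylinder]
  ext y
  simp [agreeEvent, spinEvent]

theorem empMean_mono {f g : Config p → ℝ} (h : ∀ x, f x ≤ g x) : empMean X f ≤ empMean X g :=
  mul_le_mul_of_nonneg_left (Finset.sum_le_sum fun t _ => h (X t)) (by positivity)

theorem empMean_const_le_one : empMean X (fun _ => 1) ≤ 1 := by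
  simpa [empMean, div_eq_inv_mul] using div_self_le_one (n : ℝ)

theorem sq_empMean_le (f : Config p → ℝ) : empMean X f ^ 2 ≤ empMean X fun x => f x ^ 2 := by
  rcases n.eq_zero_or_pos with rfl | hn
  · simp [empMean]
  have h := sq_sum_le_card_mul_sum_sq (s := Finset.univ) (f := fun t => f (X t))
  rw [Finset.card_univ, Fintype.card_fin] at h
  rw [empMean, empMean, mul_pow, one_div, inv_pow, inv_mul_le_iff₀ (by positivity)]
  exact h.trans_eq (by field_simp)

theorem empMean_comp {κ : Type*} [Fintype κ] (g : Config p → κ) (F : κ → ℝ) :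
    empMean X (fun x => F (g x)) = ∑ k, empProb X (g ⁻¹' {k}) * F k := by
  classical
  simp only [empMean, empProb, Finset.mul_sum, Finset.sum_mul]
  rw [Finset.sum_comm]
  refine Finset.sum_congr rfl fun t _ => ?_
  simp [Set.indicator_apply, mul_ite, ite_mul]

theorem empProb_nonneg (A : Set (Config p)) : 0 ≤ empProb X A :=
  mul_nonneg (by positivity)
    (Finset.sum_nonneg fun _ _ => Set.indicator_nonneg (fun _ _ => zero_le_one) _)

theorem empProb_mono : Monotone (empProb X) := fun _ _ h =>
  empMean_mono (Set.indicator_le_indicator_of_subset h fun _ => zero_le_one)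

theorem empCond_nonneg (A B : Set (Config p)) : 0 ≤ empCond X A B :=
  div_nonneg (empProb_nonneg _) (empProb_nonneg _)

theorem empCond_le_one (A B : Set (Config p)) : empCond X A B ≤ 1 :=
  div_le_one_of_le₀ (empProb_mono Set.inter_subset_right) (empProb_nonneg _)

/-- The empirical mean of the square of `P̂(X_u = + | X_S)`: the potential that the greedy phase
increases. -/
noncomputable def empEnergy (X : Samples p n) (u : Fin p) (S : Finset (Fin p)) : ℝ :=
  empMean X fun x => empCond X (spinEvent u true) (agreeEvent S x) ^ 2

theorem empEnergy_nonneg : 0 ≤ empEnergy X u S :=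
  mul_nonneg (by positivity) (Finset.sum_nonneg fun _ _ => sq_nonneg _)

theorem empEnergy_le_one : empEnergy X u S ≤ 1 :=
  (empMean_mono fun _ => pow_le_one₀ (empCond_nonneg _ _) (empCond_le_one _ _)).trans
    empMean_const_le_one

theorem empEnergy_eq_sum_cylinder : empEnergy X u S =
    ∑ y, empProb X (cylinder S y) * empCond X (spinEvent u true) (cylinder S y) ^ 2 := by
  simp only [empEnergy, agreeEvent_eq_cylinder]
  exact empMean_comp S.restrict fun y => empCond X (spinEvent u true) (cylinder S y) ^ 2

theorem empEnergy_insert_eq_sum_cylinder : empEnergy X u (insert i S) =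
    ∑ y, ∑ b, empProb X (spinEvent i b ∩ cylinder S y) *
      empCond X (spinEvent u true) (spinEvent i b ∩ cylinder S y) ^ 2 := by
  simp only [empEnergy, agreeEvent_insert]
  rw [empMean_comp (fun x => (S.restrict x, x i)) fun k =>
    empCond X (spinEvent u true) (spinEvent i k.2 ∩ cylinder S k.1) ^ 2, Fintype.sum_prod_type]
  refine Finset.sum_congr rfl fun y _ => Finset.sum_congr rfl fun b _ => ?_
  congr 2
  ext x
  simp [spinEvent, cylinder, and_comm]

-- The right side is the between-group variance `(c₁ c₀ / (c₁ + c₀)) (a₁ / c₁ - a₀ / c₀)²`, and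
-- the weight `2 (c₁ / (c₁ + c₀)) (c₀ / (c₁ + c₀))` on the left is at most `1 / 2`.
theorem mul_sq_weighted_sub_le {a₁ a₀ c₁ c₀ : ℝ} (h₁ : 0 ≤ a₁) (h₀ : 0 ≤ a₀) (h₁' : a₁ ≤ c₁)
    (h₀' : a₀ ≤ c₀) :
    (c₁ + c₀) * (2 * (c₁ / (c₁ + c₀)) * (c₀ / (c₁ + c₀)) * |a₁ / c₁ - a₀ / c₀|) ^ 2 ≤
      c₁ * (a₁ / c₁) ^ 2 + c₀ * (a₀ / c₀) ^ 2 - (c₁ + c₀) * ((a₁ + a₀) / (c₁ + c₀)) ^ 2 := by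
  rcases (h₁.trans h₁').eq_or_lt with hc₁ | hc₁
  · obtain rfl : a₁ = 0 := by linarith
    simp [← hc₁]
  rcases (h₀.trans h₀').eq_or_lt with hc₀ | hc₀
  · obtain rfl : a₀ = 0 := by linarith
    simp [← hc₀]
  have hvar : c₁ * (a₁ / c₁) ^ 2 + c₀ * (a₀ / c₀) ^ 2 - (c₁ + c₀) * ((a₁ + a₀) / (c₁ + c₀)) ^ 2 =
      c₁ * c₀ / (c₁ + c₀) * (a₁ / c₁ - a₀ / c₀) ^ 2 := by
    field_simp
    ring
  have hweight : 4 * (c₁ / (c₁ + c₀)) * (c₀ / (c₁ + c₀)) ≤ 1 := by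
    rw [mul_assoc, div_mul_div_comm, ← mul_div_assoc, div_le_one (by positivity)]
    nlinarith [sq_nonneg (c₁ - c₀)]
  rw [hvar, mul_pow, sq_abs]
  calc (c₁ + c₀) * ((2 * (c₁ / (c₁ + c₀)) * (c₀ / (c₁ + c₀))) ^ 2 * (a₁ / c₁ - a₀ / c₀) ^ 2)
      = 4 * (c₁ / (c₁ + c₀)) * (c₀ / (c₁ + c₀)) *
          (c₁ * c₀ / (c₁ + c₀) * (a₁ / c₁ - a₀ / c₀) ^ 2) := by field_simp; ring
    _ ≤ c₁ * c₀ / (c₁ + c₀) * (a₁ / c₁ - a₀ / c₀) ^ 2 :=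
        mul_le_of_le_one_left (by positivity) hweight

theorem empMean_weighted_nu_comp (G : ℝ → ℝ) :
    empMean X (fun x => G (empWeight X i S x * |empNu X u i S x|)) =
      ∑ y, empProb X (cylinder S y) * G (2 * empCond X (spinEvent i true) (cylinder S y) *
        empCond X (spinEvent i false) (cylinder S y) *
        |empCond X (spinEvent u true) (spinEvent i true ∩ cylinder S y) -
          empCond X (spinEvent u true) (spinEvent i false ∩ cylinder S y)|) := by
  simp only [empWeight, empNu, agreeEvent_eq_cylinder]
  exact empMean_comp S.restrict fun y => G (2 * empCond X (spinEvent i true) (cylinder S y) *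
    empCond X (spinEvent i false) (cylinder S y) *
    |empCond X (spinEvent u true) (spinEvent i true ∩ cylinder S y) -
      empCond X (spinEvent u true) (spinEvent i false ∩ cylinder S y)|)

theorem empProb_inter_spinEvent_add (i : Fin p) (A B : Set (Config p)) :
    empProb X (A ∩ (spinEvent i true ∩ B)) + empProb X (A ∩ (spinEvent i false ∩ B)) =
      empProb X (A ∩ B) := by
  rw [Set.inter_left_comm, Set.inter_left_comm A, empProb_spinEvent_add]

theorem sq_empMean_weighted_nu_le : empMean X (fun x => empWeight X i S x * |empNu X u i S x|) ^ 2 ≤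
    empEnergy X u (insert i S) - empEnergy X u S := by
  refine (sq_empMean_le _).trans ?_
  rw [empMean_weighted_nu_comp (· ^ 2), empEnergy_insert_eq_sum_cylinder,
    empEnergy_eq_sum_cylinder, ← Finset.sum_sub_distrib]
  refine Finset.sum_le_sum fun y _ => ?_
  simp only [Fintype.sum_bool, empCond, ← empProb_spinEvent_add X i (cylinder S y),
    ← empProb_inter_spinEvent_add i (spinEvent u true) (cylinder S y)]
  exact mul_sq_weighted_sub_le (empProb_nonneg _) (empProb_nonneg _)
    (empProb_mono Set.inter_subset_right) (empProb_mono Set.inter_subset_right)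

theorem sq_empInfluence_le :
    empInfluence X u i S ^ 2 ≤ empEnergy X u (insert i S) - empEnergy X u S := by
  have h := sq_empMean_weighted_nu_le (X := X) (S := S) (u := u) (i := i)
  unfold empInfluence
  split_ifs
  · simpa using (sq_nonneg _).trans h
  · exact h

theorem GreedyReach.card_mul_sq_le {τ : ℝ} (hτ : 0 ≤ τ) (h : GreedyReach X τ u S) :
    S.card * τ ^ 2 ≤ empEnergy X u S := by
  induction h with
  | empty => simpa using empEnergy_nonneg
  | add S i _ _ hi ih =>
    have hcard : ((insert i S).card : ℝ) ≤ S.card + 1 := by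
      exact_mod_cast Finset.card_insert_le i S
    calc ((insert i S).card : ℝ) * τ ^ 2
        ≤ S.card * τ ^ 2 + τ ^ 2 := by nlinarith [sq_nonneg τ]
      _ ≤ empEnergy X u S + empInfluence X u i S ^ 2 := by gcongr
      _ ≤ empEnergy X u (insert i S) := by
        linarith [sq_empInfluence_le (X := X) (u := u) (i := i) (S := S)]

theorem GreedyReach.card_le {τ : ℝ} (hτ : 0 < τ) (h : GreedyReach X τ u S) :
    (S.card : ℝ) ≤ 1 / τ ^ 2 := by
  rw [le_div_iff₀ (by positivity)]
  exact (h.card_mul_sq_le hτ.le).trans empEnergy_le_one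

end Energy

/-! ### Influences as covariances on cylinders -/

section

variable {p n : ℕ} {S : Finset (Fin p)} {u i : Fin p}

/-- The unnormalized covariance of the events `X_u = +` and `X_i = +` on the event `B`, for a
set function `m` that may be the true law or an empirical distribution. -/
noncomputable def covGap (m : Set (Config p) → ℝ) (u i : Fin p) (B : Set (Config p)) : ℝ :=
  m (spinEvent u true ∩ (spinEvent i true ∩ B)) -
    m (spinEvent u true ∩ B) * m (spinEvent i true ∩ B) / m B

/-- The average influence of `i` on `u` given `S`, written without conditional probabilities so
that it depends on `m` in a Lipschitz way. -/
noncomputable def cylInfluence (m : Set (Config p) → ℝ) (u i : Fin p) (S : Finset (Fin p)) : ℝ :=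
  2 * ∑ y, |covGap m u i (cylinder S y)|

theorem mul_abs_div_sub_div_eq {a₁ a₀ c₁ c₀ : ℝ} (h₁ : 0 ≤ a₁) (h₀ : 0 ≤ a₀) (h₁' : a₁ ≤ c₁)
    (h₀' : a₀ ≤ c₀) :
    (c₁ + c₀) * (2 * (c₁ / (c₁ + c₀)) * (c₀ / (c₁ + c₀)) * |a₁ / c₁ - a₀ / c₀|) =
      2 * |a₁ - (a₁ + a₀) * c₁ / (c₁ + c₀)| := by
  rcases eq_or_lt_of_le (h₁.trans h₁') with hc₁ | hc₁
  · obtain rfl : a₁ = 0 := by linarith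
    simp [← hc₁]
  rcases eq_or_lt_of_le (h₀.trans h₀') with hc₀ | hc₀
  · obtain rfl : a₀ = 0 := by linarith
    simp [← hc₀, hc₁.ne']
  have hgap : a₁ - (a₁ + a₀) * c₁ / (c₁ + c₀) = c₁ * c₀ / (c₁ + c₀) * (a₁ / c₁ - a₀ / c₀) := by
    field_simp
    ring
  have hpos : 0 < c₁ * c₀ / (c₁ + c₀) := by positivity
  rw [hgap, abs_mul (c₁ * c₀ / (c₁ + c₀)), abs_of_pos hpos]
  field_simp

theorem empInfluence_eq_cylInfluence {X : Samples p n} (hi : i ∉ insert u S) :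
    empInfluence X u i S = cylInfluence (empProb X) u i S := by
  rw [empInfluence, if_neg hi, cylInfluence, Finset.mul_sum, empMean_weighted_nu_comp fun a => a]
  refine Finset.sum_congr rfl fun y _ => ?_
  simp only [empCond, covGap, ← empProb_spinEvent_add X i (cylinder S y),
    ← empProb_inter_spinEvent_add i (spinEvent u true) (cylinder S y)]
  exact mul_abs_div_sub_div_eq (empProb_nonneg _) (empProb_nonneg _)
    (empProb_mono Set.inter_subset_right) (empProb_mono Set.inter_subset_right)

theorem abs_mul_le_of_abs_le_one {r x γ : ℝ} (hr : |r| ≤ 1) (hx : |x| ≤ γ) : |r * x| ≤ γ := by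
  rw [abs_mul]
  exact (mul_le_of_le_one_left (abs_nonneg x) hr).trans hx

theorem abs_div_le_one_of_le {b c : ℝ} (hb : 0 ≤ b) (hbc : b ≤ c) : |b / c| ≤ 1 := by
  rw [abs_of_nonneg (div_nonneg hb (hb.trans hbc))]
  exact div_le_one_of_le₀ hbc (hb.trans hbc)

theorem abs_mul_div_sub_le {a b c a' b' c' γ : ℝ} (hb : 0 ≤ b) (hbc : b ≤ c)
    (ha' : 0 ≤ a') (hac' : a' ≤ c')
    (h₁ : |a - a'| ≤ γ) (h₂ : |b - b'| ≤ γ) (h₃ : |c - c'| ≤ γ) :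
    |a * b / c - a' * b' / c'| ≤ 3 * γ := by
  have hr : |b / c| ≤ 1 := abs_div_le_one_of_le hb hbc
  have hs : |a' / c'| ≤ 1 := abs_div_le_one_of_le ha' hac'
  have hbr : b / c * c = b := div_mul_cancel_of_imp fun h => by linarith
  have has : a' / c' * c' = a' := div_mul_cancel_of_imp fun h => by linarith
  have hsplit : a * b / c - a' * b' / c' =
      b / c * (a - a') + a' / c' * ((b - b') - b / c * (c - c')) := by
    linear_combination a' / c' * hbr - b / c * has
  have hinner : |(b - b') - b / c * (c - c')| ≤ 2 * γ := by
    linarith [abs_sub (b - b') (b / c * (c - c')), abs_mul_le_of_abs_le_one hr h₃]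
  rw [hsplit]
  linarith [abs_add_le (b / c * (a - a')) (a' / c' * ((b - b') - b / c * (c - c'))),
    abs_mul_le_of_abs_le_one hr h₁, abs_mul_le_of_abs_le_one hs hinner]

/-- The event that the spins listed in `L` have the listed values; the empirical and the true
probabilities are compared on these events. -/
def listCylinder (L : List (Fin p × Bool)) : Set (Config p) := {x | ∀ q ∈ L, x q.1 = q.2}

theorem listCylinder_cons (i : Fin p) (b : Bool) (L : List (Fin p × Bool)) :
    listCylinder ((i, b) :: L) = spinEvent i b ∩ listCylinder L := by
  ext x
  simp [spinEvent, listCylinder]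

theorem exists_listCylinder_eq_cylinder (S : Finset (Fin p)) (y : S → Bool) :
    ∃ L : List (Fin p × Bool), L.length = S.card ∧ listCylinder L = cylinder S y := by
  refine ⟨S.attach.toList.map fun j => (j.1, y j), by simp, ?_⟩
  ext x
  simp only [cylinder, listCylinder, Set.mem_ofPred_eq, funext_iff, List.forall_mem_map,
    Finset.mem_toList, Finset.mem_attach, true_implies, Finset.restrict]

section

variable {m m' : Set (Config p) → ℝ} {γ : ℝ} {k : ℕ}

theorem abs_covGap_sub_le (hm0 : ∀ A, 0 ≤ m A) (hm : Monotone m) (hm0' : ∀ A, 0 ≤ m' A)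
    (hm' : Monotone m')
    (h : ∀ L : List (Fin p × Bool), L.length ≤ k → |m (listCylinder L) - m' (listCylinder L)| ≤ γ)
    {L : List (Fin p × Bool)} (hL : L.length + 2 ≤ k) :
    |covGap m u i (listCylinder L) - covGap m' u i (listCylinder L)| ≤ 4 * γ := by
  simp only [covGap, ← listCylinder_cons]
  have hjoint := h ((u, true) :: (i, true) :: L) (by grind)
  have hprod := abs_mul_div_sub_le (hm0 _) (hm (by grind [listCylinder_cons])) (hm0' _)
    (hm' (by grind [listCylinder_cons])) (h ((u, true) :: L) (by grind))
    (h ((i, true) :: L) (by grind)) (h L (by grind))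
  rw [sub_sub_sub_comm]
  linarith [abs_sub _ _ |>.trans (add_le_add hjoint hprod)]

theorem abs_cylInfluence_sub_le (hm0 : ∀ A, 0 ≤ m A) (hm : Monotone m) (hm0' : ∀ A, 0 ≤ m' A)
    (hm' : Monotone m')
    (h : ∀ L : List (Fin p × Bool), L.length ≤ k → |m (listCylinder L) - m' (listCylinder L)| ≤ γ)
    (hS : S.card + 2 ≤ k) :
    |cylInfluence m u i S - cylInfluence m' u i S| ≤ 8 * 2 ^ S.card * γ := by
  have hterm (y : S → Bool) :
      |(|covGap m u i (cylinder S y)| - |covGap m' u i (cylinder S y)|)| ≤ 4 * γ := by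
    obtain ⟨L, hL, hy⟩ := exists_listCylinder_eq_cylinder S y
    rw [← hy]
    exact (abs_abs_sub_abs_le_abs_sub _ _).trans
      (abs_covGap_sub_le hm0 hm hm0' hm' h (by rwa [hL]))
  calc |cylInfluence m u i S - cylInfluence m' u i S|
      = 2 * |∑ y, (|covGap m u i (cylinder S y)| - |covGap m' u i (cylinder S y)|)| := by
        rw [cylInfluence, cylInfluence, ← mul_sub, ← Finset.sum_sub_distrib, abs_mul, abs_two]
    _ ≤ 2 * ∑ _y : S → Bool, 4 * γ := by
        gcongr
        exact (Finset.abs_sum_le_sum_abs _ _).trans (Finset.sum_le_sum fun y _ => hterm y)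
    _ = 8 * 2 ^ S.card * γ := by
        simp
        ring

end

end

/-! ### Concentration of the empirical cylinder probabilities -/

section

open ProbabilityTheory

variable {Ω ι : Type*} [MeasurableSpace Ω] (μ : Measure Ω) [IsProbabilityMeasure μ] [Fintype ι]
  {f : Ω → ℝ} {a b γ : ℝ}

theorem measure_pi_card_mul_le_sum_sub_integral_le (hf : Measurable f)
    (hfab : ∀ x, f x ∈ Set.Icc a b) (hγ : 0 ≤ γ) :
    (Measure.pi fun _ : ι => μ).real
        {X | Fintype.card ι * γ ≤ ∑ t, (f (X t) - ∫ x, f x ∂μ)} ≤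
      Real.exp (-(2 * Fintype.card ι * γ ^ 2 / (b - a) ^ 2)) := by
  have hindep : iIndepFun (fun (t : ι) (X : ι → Ω) => f (X t) - ∫ x, f x ∂μ)
      (Measure.pi fun _ => μ) :=
    iIndepFun_pi (X := fun _ x => f x - ∫ x, f x ∂μ) fun _ => (hf.sub_const _).aemeasurable
  have hsubG : ∀ t ∈ (Finset.univ : Finset ι), HasSubgaussianMGF
      (fun X : ι → Ω => f (X t) - ∫ x, f x ∂μ) ((‖b - a‖₊ / 2) ^ 2) (Measure.pi fun _ => μ) := by
    intro t _
    have hint : ∫ X : ι → Ω, f (X t) ∂(Measure.pi fun _ => μ) = ∫ x, f x ∂μ :=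
      integral_comp_eval (μ := fun _ : ι => μ) hf.aestronglyMeasurable
    rw [← hint]
    exact hasSubgaussianMGF_of_mem_Icc (hf.comp (measurable_pi_apply t)).aemeasurable
      (Filter.Eventually.of_forall fun X => hfab _)
  refine (HasSubgaussianMGF.measure_sum_ge_le_of_iIndepFun hindep hsubG
    (by positivity)).trans_eq ?_
  congr 1
  simp only [Finset.sum_const, Finset.card_univ, nsmul_eq_mul, NNReal.coe_mul, NNReal.coe_natCast,
    NNReal.coe_pow, NNReal.coe_div, NNReal.coe_ofNat, coe_nnnorm, Real.norm_eq_abs, div_pow, sq_abs]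
  rcases eq_or_ne (Fintype.card ι : ℝ) 0 with h0 | h0
  · simp [h0]
  rcases eq_or_ne (b - a) 0 with hab | hab
  · simp [hab]
  field_simp

theorem measure_pi_card_mul_le_abs_sum_sub_integral_le (hf : Measurable f)
    (hfab : ∀ x, f x ∈ Set.Icc a b) (hγ : 0 ≤ γ) :
    (Measure.pi fun _ : ι => μ).real
        {X | Fintype.card ι * γ ≤ |∑ t, (f (X t) - ∫ x, f x ∂μ)|} ≤
      2 * Real.exp (-(2 * Fintype.card ι * γ ^ 2 / (b - a) ^ 2)) := by
  have hupper := measure_pi_card_mul_le_sum_sub_integral_le (ι := ι) μ hf hfab hγ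
  have hlower := measure_pi_card_mul_le_sum_sub_integral_le (ι := ι) μ hf.neg (a := -b) (b := -a)
    (fun x => ⟨neg_le_neg (hfab x).2, neg_le_neg (hfab x).1⟩) hγ
  simp only [Pi.neg_apply, integral_neg, neg_sub_neg] at hlower
  simp only [le_abs, ← Finset.sum_neg_distrib, neg_sub, Set.ofPred_or]
  exact (measureReal_union_le _ _).trans ((add_le_add hupper hlower).trans_eq (two_mul _).symm)

end

section

variable {p : ℕ} (μ : Measure (Config p)) [IsProbabilityMeasure μ] {n k : ℕ} {γ : ℝ}

theorem measure_pi_le_abs_empProb_sub_le (A : Set (Config p)) (hγ : 0 ≤ γ) (hn : 0 < n) :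
    (Measure.pi fun _ : Fin n => μ).real {X | γ ≤ |empProb X A - μ.real A|} ≤
      2 * Real.exp (-(2 * n * γ ^ 2)) := by
  have hA : MeasurableSet A := A.toFinite.measurableSet
  have hn' : (0 : ℝ) < n := by exact_mod_cast hn
  have hoeffding := measure_pi_card_mul_le_abs_sum_sub_integral_le (ι := Fin n) μ
    (f := A.indicator 1) (a := 0) (b := 1) (measurable_one.indicator hA)
    (fun x => ⟨Set.indicator_nonneg (by simp) x, Set.indicator_le_self' (by simp) x⟩) hγ
  have hsum (X : Samples p n) : ∑ t, (A.indicator (1 : Config p → ℝ) (X t) - μ.real A) =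
      n * (empProb X A - μ.real A) := by
    rw [empProb, empMean, mul_sub, ← mul_assoc, mul_one_div_cancel hn'.ne']
    simp
  simpa only [integral_indicator_one hA, hsum, abs_mul, Nat.abs_cast, Fintype.card_fin,
    mul_le_mul_iff_right₀ hn', sub_zero, one_pow, div_one] using hoeffding

/-- The samples whose empirical probabilities of all cylinders of size at most `k` are off by
less than `γ`; on this event the algorithm makes no mistake. -/
def goodSamples (μ : Measure (Config p)) (n k : ℕ) (γ : ℝ) : Set (Samples p n) :=
  {X | ∀ L : List (Fin p × Bool), L.length ≤ k →
    |empProb X (listCylinder L) - μ.real (listCylinder L)| < γ}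

theorem exists_listCylinder_eq_of_length_le {L : List (Fin p × Bool)} (hL : L.length ≤ k) :
    ∃ f : Fin k → Option (Fin p × Bool), listCylinder (List.ofFn f).reduceOption =
      listCylinder L := by
  refine ⟨fun j => L[(j : ℕ)]?, ?_⟩
  ext x
  simp only [listCylinder, Set.mem_ofPred_eq, List.reduceOption_mem_iff, List.mem_ofFn]
  refine forall_congr' fun q => imp_congr_left ?_
  rw [List.mem_iff_getElem?]
  exact ⟨fun ⟨j, hj⟩ => ⟨j, hj⟩, fun ⟨j, hj⟩ =>
    ⟨⟨j, ((List.getElem?_eq_some_iff.1 hj).1).trans_le hL⟩, hj⟩⟩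

theorem le_measure_pi_goodSamples (k : ℕ) (hγ : 0 ≤ γ) (hn : 0 < n) :
    1 - (2 * p + 1) ^ k * (2 * Real.exp (-(2 * n * γ ^ 2))) ≤
      (Measure.pi fun _ : Fin n => μ).real (goodSamples μ n k γ) := by
  let cyl (f : Fin k → Option (Fin p × Bool)) : Set (Config p) :=
    listCylinder (List.ofFn f).reduceOption
  have hcover : (goodSamples μ n k γ)ᶜ ⊆
      ⋃ f, {X | γ ≤ |empProb X (cyl f) - μ.real (cyl f)|} := by
    intro X hX
    simp only [goodSamples, Set.mem_compl_iff, Set.mem_ofPred_eq, not_forall, not_lt] at hX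
    obtain ⟨L, hL, h⟩ := hX
    obtain ⟨f, hf⟩ := exists_listCylinder_eq_of_length_le hL
    exact Set.mem_iUnion.2 ⟨f, by simpa only [cyl, hf, Set.mem_ofPred_eq] using h⟩
  have hbad : (Measure.pi fun _ : Fin n => μ).real (goodSamples μ n k γ)ᶜ ≤
      (2 * p + 1) ^ k * (2 * Real.exp (-(2 * n * γ ^ 2))) := calc
    _ ≤ ∑ f, (Measure.pi fun _ => μ).real {X | γ ≤ |empProb X (cyl f) - μ.real (cyl f)|} :=
      (measureReal_mono hcover).trans (measureReal_iUnion_fintype_le _)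
    _ ≤ ∑ _f : Fin k → Option (Fin p × Bool), 2 * Real.exp (-(2 * n * γ ^ 2)) :=
      Finset.sum_le_sum fun f _ => measure_pi_le_abs_empProb_sub_le μ (cyl f) hγ hn
    _ = _ := by simp [mul_comm (p : ℝ)]
  rw [probReal_compl_eq_one_sub (Set.toFinite _).measurableSet] at hbad
  linarith

end

/-! ### Influences in the Ising model -/

section

theorem cosh_le_exp_of_abs_le {a M : ℝ} (ha : |a| ≤ M) : Real.cosh a ≤ Real.exp M := by
  have hsinh : 0 ≤ Real.sinh |a| := Real.sinh_nonneg_iff.2 (abs_nonneg a)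
  have hexp : Real.exp |a| ≤ Real.exp M := Real.exp_le_exp.2 ha
  rw [← Real.cosh_abs]
  linarith [Real.cosh_add_sinh |a|]

theorem tanh_sub_tanh (a b : ℝ) :
    Real.tanh a - Real.tanh b = Real.sinh (a - b) / (Real.cosh a * Real.cosh b) := by
  have ha := (Real.cosh_pos a).ne'
  have hb := (Real.cosh_pos b).ne'
  rw [Real.tanh_eq_sinh_div_cosh, Real.tanh_eq_sinh_div_cosh, Real.sinh_sub]
  field_simp

theorem exp_mul_sub_le_tanh_sub_tanh {M a b : ℝ} (ha : |a| ≤ M) (hb : |b| ≤ M) (hab : b ≤ a) :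
    Real.exp (-2 * M) * (a - b) ≤ Real.tanh a - Real.tanh b := by
  have hcosh : Real.cosh a * Real.cosh b ≤ Real.exp M * Real.exp M :=
    mul_le_mul (cosh_le_exp_of_abs_le ha) (cosh_le_exp_of_abs_le hb) (Real.cosh_pos b).le
      (Real.exp_pos M).le
  have hM : Real.exp (-2 * M) * (Real.exp M * Real.exp M) = 1 := by
    rw [← Real.exp_add, ← Real.exp_add, ← Real.exp_zero]
    ring_nf
  rw [tanh_sub_tanh, le_div_iff₀ (mul_pos (Real.cosh_pos a) (Real.cosh_pos b))]
  calc Real.exp (-2 * M) * (a - b) * (Real.cosh a * Real.cosh b)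
      ≤ Real.exp (-2 * M) * (a - b) * (Real.exp M * Real.exp M) :=
        mul_le_mul_of_nonneg_left hcosh (mul_nonneg (Real.exp_pos _).le (sub_nonneg.2 hab))
    _ = a - b := by linear_combination (a - b) * hM
    _ ≤ Real.sinh (a - b) := Real.self_le_sinh_iff.2 (sub_nonneg.2 hab)

theorem exp_mul_sq_sub_le_mul_tanh_sub_tanh {M a b : ℝ} (ha : |a| ≤ M) (hb : |b| ≤ M) :
    Real.exp (-2 * M) * ((a - b) * (a - b)) ≤ (a - b) * (Real.tanh a - Real.tanh b) := by
  rcases le_total b a with h | h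
  · nlinarith [exp_mul_sub_le_tanh_sub_tanh ha hb h]
  · nlinarith [exp_mul_sub_le_tanh_sub_tanh hb ha h]

end

section

variable {ι : Type*} [Fintype ι] {w f g : ι → ℝ}

/-- The covariance of `f` and `g` under the weights `w`, which are not normalized: the result is
the total weight times the covariance under the normalized weights. -/
noncomputable def weightedCov (w f g : ι → ℝ) : ℝ :=
  ∑ x, w x * f x * g x - (∑ x, w x * f x) * (∑ x, w x * g x) / ∑ x, w x

theorem weightedCov_comm (w f g : ι → ℝ) : weightedCov w f g = weightedCov w g f := by
  simp only [weightedCov, mul_right_comm (w _), mul_comm (∑ x, w x * f x)]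

theorem weightedCov_sum_mul_left {κ : Type*} (s : Finset κ) (a : κ → ℝ) (f : κ → ι → ℝ) :
    weightedCov w (fun x => ∑ j ∈ s, a j * f j x) g = ∑ j ∈ s, a j * weightedCov w (f j) g := by
  have hlin (h : ι → ℝ) : ∑ x, w x * (∑ j ∈ s, a j * f j x) * h x =
      ∑ j ∈ s, a j * ∑ x, w x * f j x * h x := by
    simp only [Finset.mul_sum, Finset.sum_mul]
    rw [Finset.sum_comm]
    exact Finset.sum_congr rfl fun j _ => Finset.sum_congr rfl fun x _ => by ring
  have hmean := hlin fun _ => 1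
  simp only [mul_one] at hmean
  rw [weightedCov, hlin, hmean, Finset.sum_mul, Finset.sum_div, ← Finset.sum_sub_distrib]
  refine Finset.sum_congr rfl fun j _ => ?_
  rw [weightedCov]
  ring

theorem two_mul_sum_mul_weightedCov (hw : ∑ x, w x ≠ 0) :
    2 * (∑ x, w x) * weightedCov w f g =
      ∑ x, ∑ x', w x * w x' * ((f x - f x') * (g x - g x')) := by
  have hexpand (x x' : ι) : w x * w x' * ((f x - f x') * (g x - g x')) =
      w x * f x * g x * w x' + w x * (w x' * f x' * g x') - w x * f x * (w x' * g x') -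
        w x * g x * (w x' * f x') := by ring
  simp only [hexpand, Finset.sum_add_distrib, Finset.sum_sub_distrib, ← Finset.sum_mul_sum,
    weightedCov]
  field_simp
  ring

theorem weightedCov_eq_zero_of_const (hw : ∑ x, w x ≠ 0) {c : ℝ}
    (hg : ∀ x, w x ≠ 0 → g x = c) : weightedCov w f g = 0 := by
  have hconst (f : ι → ℝ) (x : ι) : w x * f x * g x = w x * f x * c := by
    rcases eq_or_ne (w x) 0 with h | h
    · simp [h]
    · rw [hg x h]
  have hsum : ∑ x, w x * g x = (∑ x, w x) * c := by
    simpa only [Pi.one_apply, mul_one, ← Finset.sum_mul] using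
      Finset.sum_congr rfl fun x (_ : x ∈ Finset.univ) => hconst 1 x
  rw [weightedCov, hsum]
  simp only [hconst, ← Finset.sum_mul]
  field_simp
  ring

theorem weightedCov_add_const_left (hw : ∑ x, w x ≠ 0) (c : ℝ) :
    weightedCov w (fun x => f x + c) g = weightedCov w f g := by
  simp only [weightedCov, mul_add, add_mul, Finset.sum_add_distrib, ← Finset.sum_mul,
    mul_right_comm (w _) c]
  field_simp
  ring

theorem mul_weightedCov_self_le (hw0 : ∀ x, 0 ≤ w x) (hw : 0 < ∑ x, w x) {c : ℝ}
    (h : ∀ x x', w x ≠ 0 → w x' ≠ 0 →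
      c * ((f x - f x') * (f x - f x')) ≤ (f x - f x') * (g x - g x')) :
    c * weightedCov w f f ≤ weightedCov w f g := by
  refine le_of_mul_le_mul_left ?_ (mul_pos two_pos hw)
  rw [mul_left_comm, two_mul_sum_mul_weightedCov hw.ne', two_mul_sum_mul_weightedCov hw.ne',
    Finset.mul_sum]
  refine Finset.sum_le_sum fun x _ => ?_
  rw [Finset.mul_sum]
  refine Finset.sum_le_sum fun x' _ => ?_
  rcases eq_or_ne (w x) 0 with hx | hx
  · simp [hx]
  rcases eq_or_ne (w x') 0 with hx' | hx'
  · simp [hx']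
  rw [mul_left_comm]
  exact mul_le_mul_of_nonneg_left (h x x' hx hx') (mul_nonneg (hw0 x) (hw0 x'))

theorem weightedCov_self (hw : ∑ x, w x ≠ 0) :
    weightedCov w f f = ∑ x, w x * (f x - (∑ x, w x * f x) / ∑ x, w x) ^ 2 := by
  generalize hb : (∑ x, w x * f x) / ∑ x, w x = b
  have hexpand (x : ι) : w x * (f x - b) ^ 2 =
      w x * f x * f x - w x * f x * (2 * b) + w x * b ^ 2 := by ring
  simp only [hexpand, Finset.sum_add_distrib, Finset.sum_sub_distrib, ← Finset.sum_mul,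
    weightedCov]
  rw [← hb]
  field_simp
  ring

theorem mul_sum_le_sum_mul_sq_sub (e : Equiv.Perm ι) (hw0 : ∀ x, 0 ≤ w x) {κ a : ℝ}
    (hκ0 : 0 ≤ κ) (hκ1 : κ ≤ 1) (hwe : ∀ x, κ * w x ≤ w (e x))
    (hf : ∀ x, a ≤ (f x - f (e x)) ^ 2) (b : ℝ) :
    1 / 4 * κ * a * ∑ x, w x ≤ ∑ x, w x * (f x - b) ^ 2 := by
  have hpair (x : ι) : 1 / 2 * κ * a * w x ≤
      w x * (f x - b) ^ 2 + w (e x) * (f (e x) - b) ^ 2 := calc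
    1 / 2 * κ * a * w x = κ * w x * (1 / 2 * a) := by ring
    _ ≤ κ * w x * ((f x - b) ^ 2 + (f (e x) - b) ^ 2) := by
      refine mul_le_mul_of_nonneg_left ?_ (mul_nonneg hκ0 (hw0 x))
      nlinarith [hf x, sq_nonneg (f x - b + (f (e x) - b))]
    _ ≤ w x * (f x - b) ^ 2 + w (e x) * (f (e x) - b) ^ 2 := by
      rw [mul_add]
      gcongr
      · exact mul_le_of_le_one_left (hw0 x) hκ1
      · exact hwe x
  have hsum := Finset.sum_le_sum fun x (_ : x ∈ Finset.univ) => hpair x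
  rw [← Finset.mul_sum, Finset.sum_add_distrib,
    Equiv.sum_comp e fun x => w x * (f x - b) ^ 2] at hsum
  linarith

end

section

variable {p : ℕ} {u i j : Fin p} {x : Config p} {θ : Param p}

theorem spin_not (b : Bool) : spin (!b) = -spin b := by
  cases b <;> norm_num [spin]

theorem abs_spin (b : Bool) : |spin b| = 1 := by
  cases b <;> simp [spin]

theorem exp_mul_spin_add_tanh (b : Bool) (a : ℝ) :
    Real.exp (-2 * (spin b * a)) * (spin b + Real.tanh a) = spin b - Real.tanh a := by
  rw [show -2 * (spin b * a) = -(spin b * a) + -(spin b * a) by ring, Real.exp_add,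
    Real.tanh_eq_sinh_div_cosh, Real.sinh_eq, Real.cosh_eq]
  have := Real.exp_pos a
  cases b <;> simp only [spin, Real.exp_neg] <;> norm_num [Real.exp_neg] <;> field_simp <;> ring

/-- The permutation of the configurations that reverses the spin at `u`. -/
def flipSpin (u : Fin p) : Equiv.Perm (Config p) :=
  Function.Involutive.toPerm (fun x => Function.update x u (!x u)) fun x => by simp

@[simp] theorem flipSpin_self (u : Fin p) (x : Config p) : flipSpin u x u = !x u :=
  Function.update_self ..

@[simp] theorem flipSpin_of_ne (h : i ≠ u) (x : Config p) : flipSpin u x i = x i :=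
  Function.update_of_ne h ..

@[simp] theorem flipSpin_flipSpin (u : Fin p) (x : Config p) : flipSpin u (flipSpin u x) = x :=
  (flipSpin u).left_inv x

theorem flipSpin_ne (u : Fin p) (x : Config p) : flipSpin u x ≠ x := fun h => by
  simpa using congrFun h u

theorem sum_mul_spin_eq_sum_mul_tanh {w a : Config p → ℝ}
    (hw : ∀ x, w (flipSpin u x) = w x * Real.exp (-2 * (spin (x u) * a x)))
    (ha : ∀ x, a (flipSpin u x) = a x) :
    ∑ x, w x * spin (x u) = ∑ x, w x * Real.tanh (a x) := by
  rw [← sub_eq_zero, ← Finset.sum_sub_distrib]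
  refine Finset.sum_involution (fun x _ => flipSpin u x) (fun x _ => ?_)
    (fun x _ _ => flipSpin_ne u x) (fun _ _ => Finset.mem_univ _) fun x _ => flipSpin_flipSpin u x
  rw [hw, ha, flipSpin_self, spin_not]
  linear_combination -w x * exp_mul_spin_add_tanh (x u) (a x)

/-- The field acting on the spin at `u`: reversing that spin lowers the energy, which here is the
exponent of the Gibbs weight, by `2 x_u` times the local field. -/
noncomputable def Param.localField (θ : Param p) (u : Fin p) (x : Config p) : ℝ :=
  ∑ j, θ.coupling u j * spin (x j) + θ.field u

/-- The probability of a configuration. -/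
noncomputable def Param.mass (θ : Param p) (x : Config p) : ℝ :=
  Real.exp (θ.energy x) / θ.partition

theorem Param.mass_pos (θ : Param p) (x : Config p) : 0 < θ.mass x :=
  div_pos (Real.exp_pos _) θ.partition_pos

theorem Param.sum_mass (θ : Param p) : ∑ x, θ.mass x = 1 := by
  simp only [mass, ← Finset.sum_div]
  exact div_self θ.partition_pos.ne'

theorem Param.real_toMeasure (θ : Param p) (A : Set (Config p)) :
    θ.pmf.toMeasure.real A = ∑ x, A.indicator θ.mass x := by
  have htop : ∀ x ∈ Finset.univ, A.indicator θ.pmf x ≠ ⊤ := fun x _ =>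
    ne_top_of_le_ne_top (θ.pmf.apply_ne_top x) (Set.indicator_le_self _ _ x)
  rw [measureReal_def, PMF.toMeasure_apply_fintype, ENNReal.toReal_sum htop]
  refine Finset.sum_congr rfl fun x _ => ?_
  by_cases hx : x ∈ A
  · simp only [Set.indicator_of_mem hx, Param.pmf, PMF.ofFintype_apply]
    exact ENNReal.toReal_ofReal (θ.mass_pos x).le
  · simp [Set.indicator_of_notMem hx]

theorem sum_sum_eq_two_mul_sum_lt {κ : Type*} [Fintype κ] [LinearOrder κ] {f : κ → κ → ℝ}
    (hdiag : ∀ k, f k k = 0) (hsymm : ∀ k l, f k l = f l k) :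
    ∑ k, ∑ l, f k l = 2 * ∑ q : κ × κ with q.1 < q.2, f q.1 q.2 := by
  have hsplit (q : κ × κ) : f q.1 q.2 =
      (if q.1 < q.2 then f q.1 q.2 else 0) + if q.2 < q.1 then f q.2 q.1 else 0 := by
    rcases lt_trichotomy q.1 q.2 with h | h | h
    · simp [h, h.not_gt]
    · simp [h, hdiag]
    · simp [h, h.not_gt, hsymm q.1]
  have hswap : ∑ q : κ × κ, (if q.2 < q.1 then f q.2 q.1 else 0) =
      ∑ q : κ × κ, if q.1 < q.2 then f q.1 q.2 else 0 :=
    Equiv.sum_comp (Equiv.prodComm κ κ) fun q => if q.1 < q.2 then f q.1 q.2 else 0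
  rw [← Fintype.sum_prod_type', Finset.sum_congr rfl fun q _ => hsplit q, Finset.sum_add_distrib,
    hswap, ← Finset.sum_filter, two_mul]

open Matrix in
theorem Param.two_mul_energy (hdiag : ∀ i, θ.coupling i i = 0) (x : Config p) :
    2 * θ.energy x = (spin ∘ x) ⬝ᵥ of θ.coupling *ᵥ (spin ∘ x) + 2 * θ.field ⬝ᵥ (spin ∘ x) := by
  have hpairs := sum_sum_eq_two_mul_sum_lt
    (f := fun i j => θ.coupling i j * (spin (x i) * spin (x j))) (fun i => by simp [hdiag])
    fun i j => by rw [θ.symm, mul_comm (spin (x i))]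
  rw [energy, mul_add, ← hpairs]
  simp only [dotProduct, mulVec, Finset.mul_sum, of_apply, Function.comp_apply, mul_left_comm]

theorem spin_comp_flipSpin (u : Fin p) (x : Config p) :
    spin ∘ flipSpin u x = spin ∘ x - Pi.single u (2 * spin (x u)) := by
  ext j
  rcases eq_or_ne j u with rfl | hj
  · simp only [Function.comp_apply, flipSpin_self, spin_not, Pi.sub_apply, Pi.single_eq_same]
    ring
  · simp [hj]

open Matrix in
theorem Param.energy_flipSpin (hdiag : ∀ i, θ.coupling i i = 0) (u : Fin p) (x : Config p) :
    θ.energy (flipSpin u x) = θ.energy x - 2 * (spin (x u) * θ.localField u x) := by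
  have hsymm : (of θ.coupling)ᵀ = of θ.coupling := Matrix.ext fun i j => θ.symm j i
  have hlocal : θ.localField u x = (of θ.coupling *ᵥ (spin ∘ x)) u + θ.field u := rfl
  have hflip := two_mul_energy hdiag (flipSpin u x)
  rw [spin_comp_flipSpin, sub_dotProduct, mulVec_sub, dotProduct_sub, dotProduct_sub,
    dotProduct_sub, single_dotProduct, single_dotProduct, dotProduct_mulVec (spin ∘ x) _
    (Pi.single _ _), ← mulVec_transpose, hsymm] at hflip
  simp only [dotProduct_single, mulVec_single, MulOpposite.op_mul, MulOpposite.op_ofNat,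
    Pi.smul_apply, col_apply, of_apply, hdiag, smul_zero, mul_zero, sub_zero] at hflip
  linear_combination (hflip - two_mul_energy hdiag x) / 2 + 2 * spin (x u) * hlocal

theorem Param.localField_flipSpin (hdiag : ∀ i, θ.coupling i i = 0) (u : Fin p) (x : Config p) :
    θ.localField u (flipSpin u x) = θ.localField u x := by
  rw [localField, localField]
  congr 1
  refine Finset.sum_congr rfl fun j _ => ?_
  rcases eq_or_ne j u with rfl | hj
  · simp [hdiag]
  · rw [flipSpin_of_ne hj]

theorem Param.mass_flipSpin (hdiag : ∀ i, θ.coupling i i = 0) (u : Fin p) (x : Config p) :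
    θ.mass (flipSpin u x) = θ.mass x * Real.exp (-2 * (spin (x u) * θ.localField u x)) := by
  rw [mass, mass, energy_flipSpin hdiag, sub_eq_add_neg, Real.exp_add, neg_mul]
  ring

theorem Param.exp_mul_mass_le_mass_flipSpin (hdiag : ∀ i, θ.coupling i i = 0) {M : ℝ}
    (hM : |θ.localField u x| ≤ M) : Real.exp (-2 * M) * θ.mass x ≤ θ.mass (flipSpin u x) := by
  have hspin : spin (x u) * θ.localField u x ≤ M :=
    (le_abs_self _).trans (by rwa [abs_mul, abs_spin, one_mul])
  rw [mass_flipSpin hdiag, mul_comm]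
  exact mul_le_mul_of_nonneg_left (Real.exp_le_exp.2 (by linarith)) (θ.mass_pos x).le

section Cylinder

variable {S : Finset (Fin p)} {y : S → Bool}

theorem flipSpin_mem_cylinder_iff (hu : u ∉ S) :
    flipSpin u x ∈ cylinder S y ↔ x ∈ cylinder S y := by
  have hrestrict : S.restrict (flipSpin u x) = S.restrict x := by
    ext j
    exact flipSpin_of_ne (ne_of_mem_of_not_mem j.2 hu) x
  simp only [cylinder, Set.mem_ofPred_eq, hrestrict]

theorem Param.indicator_mass_nonneg (θ : Param p) (B : Set (Config p)) (x : Config p) :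
    0 ≤ B.indicator θ.mass x :=
  Set.indicator_nonneg (fun x _ => (θ.mass_pos x).le) x

theorem Param.sum_indicator_cylinder_pos (θ : Param p) (y : S → Bool) :
    0 < ∑ x, (cylinder S y).indicator θ.mass x := by
  obtain ⟨x, hx⟩ : ∃ x, x ∈ cylinder S y :=
    ⟨fun j => if h : j ∈ S then y ⟨j, h⟩ else false, by ext j; simp⟩
  refine Finset.sum_pos' (fun x _ => θ.indicator_mass_nonneg _ x) ⟨x, Finset.mem_univ x, ?_⟩
  rw [Set.indicator_of_mem hx]
  exact θ.mass_pos x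

theorem Param.sum_sum_indicator_cylinder (θ : Param p) (S : Finset (Fin p)) :
    ∑ y : S → Bool, ∑ x, (cylinder S y).indicator θ.mass x = 1 := by
  classical
  rw [Finset.sum_comm, ← θ.sum_mass]
  refine Finset.sum_congr rfl fun x _ => ?_
  simp [Set.indicator_apply, cylinder]

theorem indicator_inter_spinEvent (f : Config p → ℝ) (B : Set (Config p)) (i : Fin p)
    (x : Config p) :
    (spinEvent i true ∩ B).indicator f x = B.indicator f x * ((1 + spin (x i)) / 2) := by
  by_cases hx : x ∈ B <;> cases h : x i <;> simp [spinEvent, spin, hx, h]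

theorem Param.covGap_eq_weightedCov (θ : Param p) (u i : Fin p) (y : S → Bool) :
    covGap θ.pmf.toMeasure.real u i (cylinder S y) =
      weightedCov ((cylinder S y).indicator θ.mass) (fun x => spin (x i)) (fun x => spin (x u)) /
        4 := by
  have hpos := θ.sum_indicator_cylinder_pos y
  simp only [covGap, real_toMeasure, indicator_inter_spinEvent, weightedCov]
  generalize (cylinder S y).indicator θ.mass = w at hpos ⊢
  have hsum (f : Config p → ℝ) (i : Fin p) : ∑ x, f x * ((1 + spin (x i)) / 2) =
      (∑ x, f x + ∑ x, f x * spin (x i)) / 2 := by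
    rw [← Finset.sum_add_distrib, Finset.sum_div]
    exact Finset.sum_congr rfl fun x _ => by ring
  have hjoint : ∑ x, w x * ((1 + spin (x i)) / 2) * spin (x u) =
      (∑ x, w x * spin (x u) + ∑ x, w x * spin (x i) * spin (x u)) / 2 := by
    rw [← Finset.sum_add_distrib, Finset.sum_div]
    exact Finset.sum_congr rfl fun x _ => by ring
  rw [hsum, hsum w, hsum w, hjoint]
  field_simp
  ring

theorem Param.covGap_eq_zero_of_const {c : ℝ}
    (hi : ∀ x ∈ cylinder S y, spin (x i) = c) :
    covGap θ.pmf.toMeasure.real u i (cylinder S y) = 0 := by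
  rw [covGap_eq_weightedCov, weightedCov_comm,
    weightedCov_eq_zero_of_const (θ.sum_indicator_cylinder_pos y).ne' (c := c), zero_div]
  exact fun x hx => hi x (Set.mem_of_indicator_ne_zero hx)

theorem Param.weightedCov_spin_eq_weightedCov_tanh (hdiag : ∀ i, θ.coupling i i = 0) (hu : u ∉ S)
    {F : Config p → ℝ} (hF : ∀ x, F (flipSpin u x) = F x) :
    weightedCov ((cylinder S y).indicator θ.mass) F (fun x => spin (x u)) =
      weightedCov ((cylinder S y).indicator θ.mass) F fun x => Real.tanh (θ.localField u x) := by
  classical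
  have hflip (x : Config p) : (cylinder S y).indicator θ.mass (flipSpin u x) =
      (cylinder S y).indicator θ.mass x * Real.exp (-2 * (spin (x u) * θ.localField u x)) := by
    simp only [Set.indicator_apply, flipSpin_mem_cylinder_iff hu, mass_flipSpin hdiag, ite_mul,
      zero_mul]
  rw [weightedCov, weightedCov,
    sum_mul_spin_eq_sum_mul_tanh hflip (localField_flipSpin hdiag u),
    sum_mul_spin_eq_sum_mul_tanh (w := fun x => (cylinder S y).indicator θ.mass x * F x)
      (fun x => by rw [hflip, hF, mul_right_comm]) (localField_flipSpin hdiag u)]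

theorem Param.cylInfluence_eq_zero (hdiag : ∀ i, θ.coupling i i = 0) (hu : u ∉ S) (hiu : i ≠ u)
    (hN : ∀ j ∉ S, θ.coupling u j = 0) : cylInfluence θ.pmf.toMeasure.real u i S = 0 := by
  have hlocal (y : S → Bool) : ∀ x ∈ cylinder S y, θ.localField u x =
      ∑ j : S, θ.coupling u j * spin (y j) + θ.field u := by
    rintro x rfl
    rw [localField, ← Finset.sum_subset S.subset_univ fun j _ hj => by rw [hN j hj, zero_mul],
      ← Finset.sum_coe_sort]
    rfl
  refine mul_eq_zero_of_right _ (Finset.sum_eq_zero fun y _ => abs_eq_zero.2 ?_)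
  rw [covGap_eq_weightedCov, weightedCov_spin_eq_weightedCov_tanh hdiag hu fun x => by
    rw [flipSpin_of_ne hiu], weightedCov_eq_zero_of_const (θ.sum_indicator_cylinder_pos y).ne'
    fun x hx => congrArg Real.tanh (hlocal y x (Set.mem_of_indicator_ne_zero hx)), zero_div]

theorem Param.cylInfluence_eq_zero_of_mem (hi : i ∈ S) :
    cylInfluence θ.pmf.toMeasure.real u i S = 0 :=
  mul_eq_zero_of_right _ <| Finset.sum_eq_zero fun y _ => abs_eq_zero.2 <|
    covGap_eq_zero_of_const (c := spin (y ⟨i, hi⟩)) fun _ hx => congrArg spin (congrFun hx ⟨i, hi⟩)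

theorem Param.sq_sub_localField_flipSpin (θ : Param p) (u i : Fin p) (x : Config p) :
    (θ.localField u x - θ.localField u (flipSpin i x)) ^ 2 = 4 * θ.coupling u i ^ 2 := by
  have hdiff : θ.localField u x - θ.localField u (flipSpin i x) =
      2 * θ.coupling u i * spin (x i) := by
    rw [localField, localField, add_sub_add_right_eq_sub, ← Finset.sum_sub_distrib,
      Finset.sum_eq_single i (fun j _ hj => by rw [flipSpin_of_ne hj, sub_self]) (by simp),
      flipSpin_self, spin_not]
    ring
  rw [hdiff, mul_pow, ← sq_abs (spin _), abs_spin]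
  ring

theorem Param.mul_sum_le_sum_coupling_mul_covGap (hdiag : ∀ i, θ.coupling i i = 0) {M : ℝ}
    (hM : ∀ u x, |θ.localField u x| ≤ M) (hu : u ∉ S) (hi : i ∉ S) (y : S → Bool) :
    1 / 4 * Real.exp (-2 * M) ^ 2 * θ.coupling u i ^ 2 *
        ∑ x, (cylinder S y).indicator θ.mass x ≤
      ∑ j, θ.coupling u j * covGap θ.pmf.toMeasure.real u j (cylinder S y) := by
  classical
  have hw := θ.sum_indicator_cylinder_pos y
  have hw0 := θ.indicator_mass_nonneg (cylinder S y)
  have hM0 : 0 ≤ M := (abs_nonneg _).trans (hM u default)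
  have hflip (x : Config p) : Real.exp (-2 * M) * (cylinder S y).indicator θ.mass x ≤
      (cylinder S y).indicator θ.mass (flipSpin i x) := by
    simp only [Set.indicator_apply, flipSpin_mem_cylinder_iff hi]
    split_ifs
    · exact exp_mul_mass_le_mass_flipSpin hdiag (hM i x)
    · simp
  have hvar := mul_sum_le_sum_mul_sq_sub (flipSpin i) hw0 (Real.exp_pos (-2 * M)).le
    (Real.exp_le_one_iff.2 (by linarith)) hflip
    (fun x => (θ.sq_sub_localField_flipSpin u i x).ge)
    ((∑ x, (cylinder S y).indicator θ.mass x * θ.localField u x) /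
      ∑ x, (cylinder S y).indicator θ.mass x)
  rw [← weightedCov_self hw.ne'] at hvar
  have htanh : Real.exp (-2 * M) * weightedCov ((cylinder S y).indicator θ.mass) (θ.localField u)
      (θ.localField u) ≤ _ := mul_weightedCov_self_le hw0 hw fun x x' _ _ =>
    exp_mul_sq_sub_le_mul_tanh_sub_tanh (hM u x) (hM u x')
  rw [← weightedCov_spin_eq_weightedCov_tanh hdiag hu (localField_flipSpin hdiag u)] at htanh
  have hcov : ∑ j, θ.coupling u j * covGap θ.pmf.toMeasure.real u j (cylinder S y) =
      weightedCov ((cylinder S y).indicator θ.mass) (θ.localField u) (fun x => spin (x u)) / 4 := by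
    simp only [covGap_eq_weightedCov, ← mul_div_assoc, ← Finset.sum_div]
    rw [← weightedCov_sum_mul_left, ← weightedCov_add_const_left hw.ne']
    rfl
  rw [hcov]
  nlinarith [mul_le_mul_of_nonneg_left hvar (Real.exp_pos (-2 * M)).le]

theorem Param.mul_sq_coupling_le_sum_cylInfluence (hdiag : ∀ i, θ.coupling i i = 0) {M : ℝ}
    (hM : ∀ u x, |θ.localField u x| ≤ M) (hu : u ∉ S) (hi : i ∉ S) :
    1 / 2 * Real.exp (-2 * M) ^ 2 * θ.coupling u i ^ 2 ≤
      ∑ j, |θ.coupling u j| * cylInfluence θ.pmf.toMeasure.real u j S := by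
  have hsum := Finset.sum_le_sum fun y (_ : y ∈ (Finset.univ : Finset (S → Bool))) =>
    mul_sum_le_sum_coupling_mul_covGap hdiag hM hu hi y
  rw [← Finset.mul_sum, θ.sum_sum_indicator_cylinder, mul_one, Finset.sum_comm] at hsum
  calc 1 / 2 * Real.exp (-2 * M) ^ 2 * θ.coupling u i ^ 2
      ≤ 2 * ∑ j, ∑ y, θ.coupling u j * covGap θ.pmf.toMeasure.real u j (cylinder S y) := by
        linarith
    _ ≤ 2 * ∑ j, ∑ y, |θ.coupling u j| * |covGap θ.pmf.toMeasure.real u j (cylinder S y)| := by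
        refine mul_le_mul_of_nonneg_left (Finset.sum_le_sum fun j _ => Finset.sum_le_sum fun y _ =>
          ?_) zero_le_two
        rw [← abs_mul]
        exact le_abs_self _
    _ = ∑ j, |θ.coupling u j| * cylInfluence θ.pmf.toMeasure.real u j S := by
        simp only [cylInfluence, Finset.mul_sum, mul_left_comm]

end Cylinder

end

/-! ### The model on a graph of bounded degree -/

section

variable {p d : ℕ} {G : SimpleGraph (Fin p)} {θ : Param p} {α β h : ℝ} {u i : Fin p}
  {S : Finset (Fin p)}

theorem Param.Valid.coupling_self (hθ : θ.Valid G α β h) (i : Fin p) : θ.coupling i i = 0 :=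
  hθ.coupling_eq_zero i i (G.loopless.irrefl i)

variable [DecidableRel G.Adj]

theorem Param.Valid.abs_localField_le (hθ : θ.Valid G α β h) (hG : ∀ i, G.degree i ≤ d)
    (hβ : 0 ≤ β) (u : Fin p) (x : Config p) : |θ.localField u x| ≤ β * d + h := by
  have hterm (j : Fin p) (hj : j ∈ G.neighborFinset u) : |θ.coupling u j * spin (x j)| ≤ β := by
    rw [abs_mul, abs_spin, mul_one]
    exact hθ.coupling_le u j (by simpa using hj)
  have hcoupling : |∑ j, θ.coupling u j * spin (x j)| ≤ β * d := calc
    _ = |∑ j ∈ G.neighborFinset u, θ.coupling u j * spin (x j)| := by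
      rw [← Finset.sum_subset (Finset.subset_univ (G.neighborFinset u)) fun j _ hj => by
        rw [hθ.coupling_eq_zero u j (by simpa using hj), zero_mul]]
    _ ≤ ∑ _j ∈ G.neighborFinset u, β :=
      (Finset.abs_sum_le_sum_abs _ _).trans (Finset.sum_le_sum hterm)
    _ ≤ β * d := by
      rw [Finset.sum_const, G.card_neighborFinset_eq_degree, nsmul_eq_mul, mul_comm]
      exact mul_le_mul_of_nonneg_left (by exact_mod_cast hG u) hβ
  exact (abs_add_le _ _).trans (add_le_add hcoupling (hθ.field_le u))

theorem Param.Valid.cylInfluence_eq_zero (hθ : θ.Valid G α β h) (hu : u ∉ S) (hiu : i ≠ u)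
    (hN : G.neighborFinset u ⊆ S) : cylInfluence θ.pmf.toMeasure.real u i S = 0 :=
  Param.cylInfluence_eq_zero hθ.coupling_self hu hiu fun j hj =>
    hθ.coupling_eq_zero u j fun hadj => hj (hN (by simpa using hadj))

theorem Param.Valid.exists_cylInfluence_ge (hθ : θ.Valid G α β h) (hG : ∀ i, G.degree i ≤ d)
    (hα : 0 < α) (hαβ : α ≤ β) (hu : u ∉ S) (hN : ¬ G.neighborFinset u ⊆ S) :
    ∃ i ∈ G.neighborFinset u \ S, 2 * delta d β h ^ 2 * α ^ 2 / (d * β) ≤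
      cylInfluence θ.pmf.toMeasure.real u i S := by
  have hβ : 0 < β := hα.trans_le hαβ
  obtain ⟨i, hiN, hiS⟩ := Finset.not_subset.1 hN
  have hcard : ((G.neighborFinset u \ S).card : ℝ) ≤ d := by
    exact_mod_cast (Finset.card_le_card Finset.sdiff_subset).trans (hG u)
  have hd : (0 : ℝ) < d := lt_of_lt_of_le (by
    exact_mod_cast Finset.card_pos.2 ⟨i, Finset.mem_sdiff.2 ⟨hiN, hiS⟩⟩) hcard
  have hlow : 2 * delta d β h ^ 2 * α ^ 2 ≤
      ∑ j, |θ.coupling u j| * cylInfluence θ.pmf.toMeasure.real u j S := by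
    refine le_trans ?_ (Param.mul_sq_coupling_le_sum_cylInfluence hθ.coupling_self
      (hθ.abs_localField_le hG hβ.le) hu hiS)
    have hαi : α ^ 2 ≤ θ.coupling u i ^ 2 := by
      rw [← sq_abs (θ.coupling u i)]
      exact pow_le_pow_left₀ hα.le (hθ.coupling_ge u i (by simpa using hiN)) 2
    calc 2 * delta d β h ^ 2 * α ^ 2
        = 1 / 2 * Real.exp (-2 * (β * d + h)) ^ 2 * α ^ 2 := by rw [delta]; ring
      _ ≤ _ := mul_le_mul_of_nonneg_left hαi (by positivity)
  have hsupport : ∑ j, |θ.coupling u j| * cylInfluence θ.pmf.toMeasure.real u j S =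
      ∑ j ∈ G.neighborFinset u \ S,
        |θ.coupling u j| * cylInfluence θ.pmf.toMeasure.real u j S := by
    refine (Finset.sum_subset (Finset.subset_univ _) fun j _ hj => ?_).symm
    by_cases hjS : j ∈ S
    · rw [Param.cylInfluence_eq_zero_of_mem hjS, mul_zero]
    · rw [hθ.coupling_eq_zero u j fun hadj => hj (by simp [hadj, hjS]), abs_zero, zero_mul]
  by_contra! hsmall
  refine hlow.not_gt ?_
  calc ∑ j, |θ.coupling u j| * cylInfluence θ.pmf.toMeasure.real u j S
      ≤ ∑ j ∈ G.neighborFinset u \ S, β * cylInfluence θ.pmf.toMeasure.real u j S := by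
        rw [hsupport]
        gcongr with _ hj
        · exact mul_nonneg zero_le_two (Finset.sum_nonneg fun _ _ => abs_nonneg _)
        · exact hθ.coupling_le u _ (by simpa using (Finset.mem_sdiff.1 hj).1)
    _ < ∑ j ∈ G.neighborFinset u \ S, β * (2 * delta d β h ^ 2 * α ^ 2 / (d * β)) :=
        Finset.sum_lt_sum_of_nonempty ⟨i, Finset.mem_sdiff.2 ⟨hiN, hiS⟩⟩ fun j hj =>
          mul_lt_mul_of_pos_left (hsmall j hj) hβ
    _ ≤ d * (β * (2 * delta d β h ^ 2 * α ^ 2 / (d * β))) := by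
        rw [Finset.sum_const, nsmul_eq_mul]
        gcongr
    _ = 2 * delta d β h ^ 2 * α ^ 2 := by field_simp

end

/-! ### The constants -/

section

variable {d : ℕ} {α β h : ℝ}

theorem delta_pos : 0 < delta d β h :=
  mul_pos one_half_pos (Real.exp_pos _)

theorem delta_le_half (hβ : 0 ≤ β) (hh : 0 ≤ h) : delta d β h ≤ 1 / 2 := by
  have hm : 0 ≤ β * d + h := by positivity
  exact mul_le_of_le_one_right one_half_pos.le (Real.exp_le_one_iff.2 (by linarith))

theorem delta_le_one (hβ : 0 ≤ β) (hh : 0 ≤ h) : delta d β h ≤ 1 :=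
  (delta_le_half hβ hh).trans one_half_lt_one.le

theorem exp_neg_two_mul_le_delta : Real.exp (-2 * (β * d + h + 1)) ≤ delta d β h := by
  have htwo : Real.exp (-2) ≤ 1 / 2 := by
    rw [Real.exp_neg, one_div]
    exact inv_anti₀ two_pos (by linarith [Real.add_one_le_exp 2])
  rw [mul_add, Real.exp_add, mul_one, mul_comm]
  exact mul_le_mul_of_nonneg_right htwo (Real.exp_pos _).le

theorem tauStar_pos (hd : 1 ≤ d) (hα : 0 < α) (hβ : 0 < β) : 0 < tauStar d α β h := by
  have hδ := delta_pos (d := d) (β := β) (h := h)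
  unfold tauStar
  positivity

theorem tauStar_le (hd : 1 ≤ d) (hβ : 0 ≤ β) (hh : 0 ≤ h) :
    tauStar d α β h ≤ delta d β h ^ 2 * α ^ 2 / (d * β) := by
  have hpow : delta d β h ^ (4 * d + 1) ≤ delta d β h ^ 2 :=
    pow_le_pow_of_le_one delta_pos.le (delta_le_one hβ hh) (by lia)
  calc tauStar d α β h = 1 / 16 * (delta d β h ^ (4 * d + 1) * α ^ 2 / (d * β)) := by
        rw [tauStar]
        ring
    _ ≤ 1 * (delta d β h ^ 2 * α ^ 2 / (d * β)) := by
        have hδ := delta_pos (d := d) (β := β) (h := h)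
        gcongr
        norm_num
    _ = delta d β h ^ 2 * α ^ 2 / (d * β) := one_mul _

theorem delta_mul_le_one (hd : 1 ≤ d) (hβ : 0 ≤ β) (hh : 0 ≤ h) : delta d β h * β ≤ 1 := by
  have hd' : (1 : ℝ) ≤ d := by exact_mod_cast hd
  have hexp : Real.exp (-2 * (β * d + h)) ≤ Real.exp (-β) := Real.exp_le_exp.2 (by nlinarith)
  have hdelta : delta d β h ≤ Real.exp (-β) := by
    rw [delta]
    linarith [Real.exp_pos (-β)]
  calc delta d β h * β ≤ Real.exp (-β) * Real.exp β :=
        mul_le_mul hdelta (by linarith [Real.add_one_le_exp β]) hβ (Real.exp_pos _).le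
    _ = 1 := by rw [← Real.exp_add, neg_add_cancel, Real.exp_zero]

theorem tauStar_le_one (hd : 1 ≤ d) (hα : 0 ≤ α) (hαβ : α ≤ β) (hh : 0 ≤ h) :
    tauStar d α β h ≤ 1 := by
  have hβ : 0 ≤ β := hα.trans hαβ
  have hd' : (1 : ℝ) ≤ d := by exact_mod_cast hd
  have hδ := delta_pos (d := d) (β := β) (h := h)
  refine div_le_one_of_le₀ ?_ (by positivity)
  calc α ^ 2 * delta d β h ^ (4 * d + 1) ≤ β ^ 2 * delta d β h :=
        mul_le_mul (pow_le_pow_left₀ hα hαβ 2)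
          (pow_le_of_le_one hδ.le (delta_le_one hβ hh) (Nat.succ_ne_zero _)) (by positivity)
          (by positivity)
    _ = β * (delta d β h * β) := by ring
    _ ≤ β * (16 * d) :=
        mul_le_mul_of_nonneg_left (by linarith [delta_mul_le_one hd hβ hh]) hβ
    _ = 16 * d * β := mul_comm _ _

theorem one_div_tauStar_sq : 1 / tauStar d α β h ^ 2 = ellStar d α β h / 8 := by
  rw [ellStar]
  ring

theorem ellStar_nonneg : 0 ≤ ellStar d α β h :=
  div_nonneg (by norm_num) (sq_nonneg _)

theorem eight_le_ellStar (hd : 1 ≤ d) (hα : 0 < α) (hαβ : α ≤ β) (hh : 0 ≤ h) :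
    8 ≤ ellStar d α β h := by
  have hτ := tauStar_pos (h := h) hd hα (hα.trans_le hαβ)
  rw [ellStar, le_div_iff₀ (pow_pos hτ 2)]
  linarith [pow_le_one₀ (n := 2) hτ.le (tauStar_le_one hd hα.le hαβ hh)]

theorem sampleCoeff_pos (hd : 1 ≤ d) (hα : 0 < α) (hβ : 0 < β) : 0 < sampleCoeff d α β h := by
  have hτ := tauStar_pos (h := h) hd hα hβ
  have hδ := delta_pos (d := d) (β := β) (h := h)
  have hℓ := ellStar_nonneg (d := d) (α := α) (β := β) (h := h)
  unfold sampleCoeff epsStar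
  positivity

theorem one_div_tauStar_le (hd : 1 ≤ d) (hα : 0 < α) (hβ : 0 < β) (hh : 0 ≤ h) :
    1 / tauStar d α β h ≤ 16 / α ^ 2 * Real.exp (11 * (d * (β * d + h + 1))) := by
  have hd' : (1 : ℝ) ≤ d := by exact_mod_cast hd
  have hδ := delta_pos (d := d) (β := β) (h := h)
  have hm : 0 ≤ β * d + h + 1 := by positivity
  have hpow : 1 / delta d β h ^ (4 * d + 1) ≤ Real.exp (10 * (d * (β * d + h + 1))) := by
    rw [one_div, ← inv_pow]
    calc (delta d β h)⁻¹ ^ (4 * d + 1) ≤ Real.exp (2 * (β * d + h + 1)) ^ (4 * d + 1) := by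
          refine pow_le_pow_left₀ (inv_nonneg.2 hδ.le) ?_ _
          rw [inv_le_comm₀ hδ (Real.exp_pos _), ← Real.exp_neg, ← neg_mul]
          exact exp_neg_two_mul_le_delta
      _ = Real.exp ((4 * d + 1) * (2 * (β * d + h + 1))) := by
          rw [← Real.exp_nat_mul]
          push_cast
          rfl
      _ ≤ Real.exp (10 * (d * (β * d + h + 1))) := Real.exp_le_exp.2 (by nlinarith)
  have hdβ : d * β ≤ Real.exp (d * (β * d + h + 1)) :=
    calc d * β ≤ d * (β * d + h + 1) := mul_le_mul_of_nonneg_left (by nlinarith) (by positivity)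
      _ ≤ Real.exp (d * (β * d + h + 1)) := by
        linarith [Real.add_one_le_exp (d * (β * d + h + 1))]
  calc 1 / tauStar d α β h = 16 / α ^ 2 * (d * β * (1 / delta d β h ^ (4 * d + 1))) := by
        rw [tauStar]
        field_simp
    _ ≤ 16 / α ^ 2 *
        (Real.exp (d * (β * d + h + 1)) * Real.exp (10 * (d * (β * d + h + 1)))) := by
        gcongr
    _ = 16 / α ^ 2 * Real.exp (11 * (d * (β * d + h + 1))) := by
        rw [← Real.exp_add]
        ring_nf

theorem ellStar_le (hd : 1 ≤ d) (hα : 0 < α) (hβ : 0 < β) (hh : 0 ≤ h) :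
    ellStar d α β h ≤ 2048 * α ^ (-4 : ℝ) * Real.exp (22 * (d * (β * d + h + 1))) := by
  have hτ := tauStar_pos (h := h) hd hα hβ
  calc ellStar d α β h = 8 * (1 / tauStar d α β h) ^ 2 := by
        rw [ellStar]
        ring
    _ ≤ 8 * (16 / α ^ 2 * Real.exp (11 * (d * (β * d + h + 1)))) ^ 2 := by
        gcongr
        exact one_div_tauStar_le hd hα hβ hh
    _ = 2048 * α ^ (-4 : ℝ) * Real.exp (22 * (d * (β * d + h + 1))) := by
        rw [mul_pow, ← Real.exp_nat_mul, Real.rpow_neg hα.le, Real.rpow_ofNat]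
        push_cast
        ring_nf

theorem one_div_delta_rpow_le {x : ℝ} (hx : 0 ≤ x) :
    1 / delta d β h ^ x ≤ Real.exp (2 * (β * d + h + 1) * x) := by
  rw [one_div_le (Real.rpow_pos_of_pos delta_pos x) (Real.exp_pos _), one_div, ← Real.exp_neg,
    ← neg_mul, ← neg_mul, Real.exp_mul]
  exact Real.rpow_le_rpow (Real.exp_pos _).le exp_neg_two_mul_le_delta hx

theorem mul_add_three_mul_self_le_exp {x : ℝ} (hx : 8 ≤ x) :
    72 * (x + 3) * x ≤ Real.exp (2 * x) := by
  have hfactorial := Real.pow_div_factorial_le_exp (2 * x) (by linarith) 5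
  have hcube : 8 ^ 3 ≤ x ^ 3 := pow_le_pow_left₀ (by norm_num) hx 3
  norm_num [Nat.factorial] at hfactorial
  nlinarith [mul_le_mul_of_nonneg_right hcube (sq_nonneg x)]

theorem sampleCoeff_le (hd : 1 ≤ d) (hα : 0 < α) (hαβ : α ≤ β) (hh : 0 ≤ h) :
    sampleCoeff d α β h ≤
      Real.exp (12288 * α ^ (-4 : ℝ) * Real.exp (23 * d * (β * d + h + 1))) := by
  have hβ : 0 < β := hα.trans_le hαβ
  have hd' : (1 : ℝ) ≤ d := by exact_mod_cast hd
  have hm : 1 ≤ β * d + h + 1 := by nlinarith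
  have hℓ := eight_le_ellStar hd hα hαβ hh
  have hℓle := ellStar_le hd hα hβ hh
  have hrpow : 1 / delta d β h ^ (2 * ellStar d α β h) ≤ _ := one_div_delta_rpow_le (by linarith)
  have hcoeff : sampleCoeff d α β h = 72 * (ellStar d α β h + 3) * ellStar d α β h *
      (1 / delta d β h ^ (2 * ellStar d α β h)) := by
    have hdef : ellStar d α β h = 8 / tauStar d α β h ^ 2 := rfl
    rw [sampleCoeff, epsStar]
    linear_combination
      -(72 * (ellStar d α β h + 3) / delta d β h ^ (2 * ellStar d α β h)) * hdef
  have hexp : β * d + h + 1 ≤ Real.exp (d * (β * d + h + 1)) := by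
    nlinarith [Real.add_one_le_exp (d * (β * d + h + 1))]
  calc sampleCoeff d α β h
      ≤ Real.exp (2 * ellStar d α β h) *
          Real.exp (2 * (β * d + h + 1) * (2 * ellStar d α β h)) := by
        rw [hcoeff]
        exact mul_le_mul (mul_add_three_mul_self_le_exp hℓ) hrpow
          (one_div_nonneg.2 (Real.rpow_pos_of_pos delta_pos _).le) (Real.exp_pos _).le
    _ ≤ Real.exp (6 * (ellStar d α β h * Real.exp (d * (β * d + h + 1)))) := by
        rw [← Real.exp_add, Real.exp_le_exp]
        nlinarith
    _ ≤ Real.exp (6 * (2048 * α ^ (-4 : ℝ) * Real.exp (22 * (d * (β * d + h + 1))) *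
          Real.exp (d * (β * d + h + 1)))) := by
        gcongr
    _ = Real.exp (12288 * α ^ (-4 : ℝ) * Real.exp (23 * d * (β * d + h + 1))) := by
        rw [mul_assoc _ (Real.exp _), ← Real.exp_add]
        ring_nf

end

/-! ### Correctness and running time -/

section

variable {p n d : ℕ} {α β h ζ τ : ℝ} {X : Samples p n} {u : Fin p} {S N : Finset (Fin p)}

theorem foldl_pruneStep_eq_sdiff (l : List (Fin p)) (hNS : N ⊆ S)
    (hN : ∀ T ⊆ S, N ⊆ T → ∀ i ∈ T, empInfluence X u i (T.erase i) < τ ↔ i ∉ N) :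
    l.foldl (pruneStep X τ u) S = S \ (l.toFinset \ N) := by
  induction l generalizing S with
  | nil => simp
  | cons i l ih =>
    have hstep : pruneStep X τ u S i = S \ ({i} \ N) := by
      rw [pruneStep]
      by_cases hiS : i ∈ S
      · by_cases hiN : i ∈ N
        · rw [if_neg fun hlt => (hN S subset_rfl hNS i hiS).1 hlt hiN,
            Finset.sdiff_eq_empty_iff_subset.2 (Finset.singleton_subset_iff.2 hiN),
            Finset.sdiff_empty]
        · rw [if_pos ((hN S subset_rfl hNS i hiS).2 hiN), Finset.sdiff_eq_self_of_disjoint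
            (Finset.disjoint_singleton_left.2 hiN), Finset.sdiff_singleton_eq_erase]
      · rw [Finset.erase_eq_of_notMem hiS, ite_self]
        exact (Finset.sdiff_eq_self_of_disjoint (Finset.disjoint_of_subset_right
          Finset.sdiff_subset (Finset.disjoint_singleton_right.2 hiS))).symm
    have hsub : S \ ({i} \ N) ⊆ S := Finset.sdiff_subset
    rw [List.foldl_cons, hstep, ih (Finset.subset_sdiff.2 ⟨hNS, Finset.disjoint_sdiff⟩)
      fun T hT => hN T (hT.trans hsub), List.toFinset_cons, Finset.insert_eq,
      Finset.union_sdiff_distrib, sdiff_sdiff_left, Finset.sup_eq_union]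

theorem LearnNbhd.eq_of_threshold (hτ : 0 < τ)
    (hlarge : ∀ T, u ∉ T → (T.card : ℝ) ≤ 1 / τ ^ 2 → ¬ N ⊆ T →
      ∃ i ∈ N \ T, τ ≤ empInfluence X u i T)
    (hsmall : ∀ T, u ∉ T → (T.card : ℝ) ≤ 1 / τ ^ 2 → N ⊆ T →
      ∀ i ∉ insert u T, empInfluence X u i T < τ)
    {R : Finset (Fin p)} (hR : LearnNbhd X τ u R) : R = N := by
  obtain ⟨S, l, ⟨hS, hlt⟩, -, rfl, rfl⟩ := hR
  have hu {T : Finset (Fin p)} (hT : T ⊆ l.toFinset) : u ∉ T :=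
    fun hmem => hS.self_notMem hτ (hT hmem)
  have hcard {T : Finset (Fin p)} (hT : T ⊆ l.toFinset) : (T.card : ℝ) ≤ 1 / τ ^ 2 :=
    le_trans (by exact_mod_cast Finset.card_le_card hT) (hS.card_le hτ)
  have hNS : N ⊆ l.toFinset := by
    by_contra hN
    obtain ⟨i, -, hi⟩ := hlarge _ (hu subset_rfl) (hcard subset_rfl) hN
    exact hi.not_gt (hlt i)
  rw [foldl_pruneStep_eq_sdiff l hNS, Finset.sdiff_sdiff_eq_self hNS]
  intro T hT hNT i hi
  have herase : T.erase i ⊆ l.toFinset := (Finset.erase_subset i T).trans hT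
  by_cases hiN : i ∈ N
  · obtain ⟨j, hj, hle⟩ := hlarge (T.erase i) (hu herase) (hcard herase)
      fun hsub => Finset.notMem_erase i T (hsub hiN)
    have hji : j = i := by
      by_contra hne
      have hjN := Finset.mem_sdiff.1 hj
      exact hjN.2 (Finset.mem_erase.2 ⟨hne, hNT hjN.1⟩)
    rw [hji] at hle
    simp [hiN, hle]
  · refine iff_of_true (hsmall (T.erase i) (hu herase) (hcard herase)
      (Finset.subset_erase.2 ⟨hNT, hiN⟩) i ?_) hiN
    simp [ne_of_mem_of_not_mem hi (hu hT)]

theorem LearnNbhd.eq_neighborFinset {G : SimpleGraph (Fin p)} [DecidableRel G.Adj] {θ : Param p}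
    (hG : ∀ i, G.degree i ≤ d) (hθ : θ.Valid G α β h) (hα : 0 < α) (hαβ : α ≤ β) (hτ : 0 < τ)
    (hτle : τ ≤ delta d β h ^ 2 * α ^ 2 / (d * β))
    (hclose : ∀ (i : Fin p) (S : Finset (Fin p)), (S.card : ℝ) ≤ 1 / τ ^ 2 → i ∉ insert u S →
      |empInfluence X u i S - cylInfluence θ.pmf.toMeasure.real u i S| ≤ τ / 2)
    {R : Finset (Fin p)} (hR : LearnNbhd X τ u R) : R = G.neighborFinset u := by
  refine hR.eq_of_threshold hτ (fun T hu hcard hN => ?_) fun T hu hcard hN i hi => ?_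
  · obtain ⟨i, hi, hle⟩ := hθ.exists_cylInfluence_ge hG hα hαβ hu hN
    have hiT : i ∉ insert u T := by
      rintro hmem
      rcases Finset.mem_insert.1 hmem with rfl | hmem
      · simp at hi
      · exact (Finset.mem_sdiff.1 hi).2 hmem
    refine ⟨i, hi, ?_⟩
    rw [mul_assoc, mul_div_assoc] at hle
    linarith [(abs_le.1 (hclose i T hcard hiT)).1]
  · have hzero := hθ.cylInfluence_eq_zero hu (fun hiu => hi (Finset.mem_insert.2 (Or.inl hiu))) hN
    linarith [(abs_le.1 (hclose i T hcard hi)).2]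

theorem abs_empInfluence_sub_le {μ : Measure (Config p)} [IsFiniteMeasure μ] {k : ℕ}
    (hX : X ∈ goodSamples μ n (k + 2) (τ / (16 * 2 ^ k))) (hτ : 0 ≤ τ) {i : Fin p}
    (hS : S.card ≤ k) (hi : i ∉ insert u S) :
    |empInfluence X u i S - cylInfluence μ.real u i S| ≤ τ / 2 := by
  rw [empInfluence_eq_cylInfluence hi]
  calc |cylInfluence (empProb X) u i S - cylInfluence μ.real u i S|
      ≤ 8 * 2 ^ S.card * (τ / (16 * 2 ^ k)) :=
        abs_cylInfluence_sub_le empProb_nonneg empProb_mono (fun _ => measureReal_nonneg)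
          (fun _ _ hAB => measureReal_mono hAB) (fun L hL => (hX L hL).le)
          (Nat.add_le_add_right hS 2)
    _ ≤ 8 * 2 ^ k * (τ / (16 * 2 ^ k)) := by
        gcongr
        exact one_le_two
    _ = τ / 2 := by
        field_simp
        ring

theorem card_mul_exp_le (hp : 2 ≤ p) (hζ : 0 < ζ) (hζ1 : ζ < 1) {k : ℕ} {x : ℝ}
    (hx : (3 * k + 1) * Real.log (p / ζ) ≤ x) :
    (2 * p + 1) ^ k * (2 * Real.exp (-x)) ≤ ζ := by
  have hp2 : (2 : ℝ) ≤ p := by exact_mod_cast hp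
  have hp0 : (0 : ℝ) < p := by linarith
  have hpoly : (2 * (p : ℝ) + 1) ^ k ≤ p ^ (3 * k) := by
    rw [pow_mul]
    exact pow_le_pow_left₀ (by positivity) (by nlinarith [pow_le_pow_left₀ zero_le_two hp2 2]) k
  have hexp : Real.exp (-x) ≤ (ζ / p) ^ (3 * k + 1) := by
    rw [← inv_div, inv_pow, Real.exp_neg, ← Real.exp_log (div_pos hp0 hζ), ← Real.exp_nat_mul]
    refine inv_anti₀ (Real.exp_pos _) (Real.exp_le_exp.2 ?_)
    exact_mod_cast hx
  calc (2 * (p : ℝ) + 1) ^ k * (2 * Real.exp (-x))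
      ≤ p ^ (3 * k) * (p * (ζ / p) ^ (3 * k + 1)) := by gcongr
    _ = ζ ^ (3 * k + 1) := by
        rw [div_pow]
        field_simp
        ring
    _ ≤ ζ := pow_le_of_le_one hζ.le hζ1.le (Nat.succ_ne_zero _)

theorem delta_rpow_mul_two_pow_le_one (hβ : 0 ≤ β) (hh : 0 ≤ h) {x : ℝ} {k : ℕ}
    (hk : (k : ℝ) ≤ x) :
    delta d β h ^ (2 * x) * (2 ^ k) ^ 2 ≤ 1 := by
  calc delta d β h ^ (2 * x) * (2 ^ k) ^ 2 ≤ delta d β h ^ (2 * (k : ℝ)) * (2 ^ k) ^ 2 := by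
        gcongr ?_ * _
        exact Real.rpow_le_rpow_of_exponent_ge delta_pos (delta_le_one hβ hh) (by linarith)
    _ = (delta d β h * 2) ^ (2 * k) := by
        rw [mul_pow, ← pow_mul, mul_comm k 2, ← Real.rpow_natCast (delta d β h), Nat.cast_mul,
          Nat.cast_ofNat]
    _ ≤ 1 := pow_le_one₀ (mul_pos delta_pos two_pos).le (by linarith [delta_le_half hβ hh (d := d)])

theorem three_mul_add_one_mul_le_of_sampleCoeff_mul_le (hd : 1 ≤ d) (hα : 0 < α) (hβ : 0 < β)
    (hh : 0 ≤ h) {L : ℝ} (hL : 0 ≤ L) (hn : sampleCoeff d α β h * L ≤ n) {k : ℕ}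
    (hk : (k : ℝ) ≤ ellStar d α β h) :
    (3 * ((k + 2 : ℕ) : ℝ) + 1) * L ≤ 2 * n * (tauStar d α β h / (16 * 2 ^ k)) ^ 2 := by
  have hτ := tauStar_pos (h := h) hd hα hβ
  have hδ := Real.rpow_pos_of_pos (delta_pos (d := d) (β := β) (h := h)) (2 * ellStar d α β h)
  have hℓ := ellStar_nonneg (d := d) (α := α) (β := β) (h := h)
  calc (3 * ((k + 2 : ℕ) : ℝ) + 1) * L ≤ 9 / 2 * (ellStar d α β h + 3) * L := by
        gcongr
        push_cast
        linarith
    _ ≤ 9 / 2 * (ellStar d α β h + 3) /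
          (delta d β h ^ (2 * ellStar d α β h) * (2 ^ k) ^ 2) * L := by
        gcongr
        exact le_div_self (by positivity) (by positivity)
          (delta_rpow_mul_two_pow_le_one hβ.le hh hk)
    _ = 2 * (sampleCoeff d α β h * L) * (tauStar d α β h / (16 * 2 ^ k)) ^ 2 := by
        rw [sampleCoeff, epsStar]
        field_simp
        ring
    _ ≤ 2 * n * (tauStar d α β h / (16 * 2 ^ k)) ^ 2 := by gcongr

instance (θ : Param p) (n : ℕ) : IsProbabilityMeasure (θ.sampleLaw n) :=
  inferInstanceAs (IsProbabilityMeasure (Measure.pi fun _ : Fin n => θ.pmf.toMeasure))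

theorem pos_of_sampleBound_le (hd : 1 ≤ d) (hα : 0 < α) (hβ : 0 < β) (hζ : 0 < ζ) (hζ1 : ζ < 1)
    (hp : 1 ≤ p) (hn : sampleBound d α β h ζ p ≤ n) : 0 < n := by
  have hp' : (1 : ℝ) ≤ p := by exact_mod_cast hp
  have hlog : 0 < Real.log (p / ζ) := Real.log_pos (by rw [lt_div_iff₀ hζ]; linarith)
  exact_mod_cast (mul_pos (sampleCoeff_pos hd hα hβ) hlog).trans_le hn

theorem le_sampleLaw_learnNbhd_eq {G : SimpleGraph (Fin p)} [DecidableRel G.Adj] {θ : Param p}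
    (hG : ∀ i, G.degree i ≤ d) (hθ : θ.Valid G α β h) (hd : 1 ≤ d) (hα : 0 < α) (hαβ : α ≤ β)
    (hh : 0 ≤ h) (hζ : 0 < ζ) (hζ1 : ζ < 1) (hn : sampleBound d α β h ζ p ≤ n) :
    1 - ζ ≤ (θ.sampleLaw n).real {X | ∀ u R, LearnNbhd X (tauStar d α β h) u R →
      R = G.neighborFinset u} := by
  have hβ : 0 < β := hα.trans_le hαβ
  have hτ := tauStar_pos (h := h) hd hα hβ
  have hτle := tauStar_le (α := α) hd hβ.le hh
  rcases lt_or_ge p 2 with hp | hp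
  · have huniv : {X : Samples p n | ∀ u R, LearnNbhd X (tauStar d α β h) u R →
        R = G.neighborFinset u} = Set.univ := by
      refine Set.eq_univ_of_forall fun X u R hR =>
        hR.eq_neighborFinset hG hθ hα hαβ hτ hτle fun i S _ hi => ?_
      have hiu : i = u := Fin.ext (by lia)
      simp [hiu] at hi
    rw [huniv, probReal_univ]
    linarith
  have hlog : 0 ≤ Real.log (p / ζ) :=
    Real.log_nonneg (by
      rw [le_div_iff₀ hζ]
      linarith [show (2 : ℝ) ≤ p by exact_mod_cast hp])
  set k := ⌊ellStar d α β h⌋₊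
  have hkle : (k : ℝ) ≤ ellStar d α β h := Nat.floor_le ellStar_nonneg
  have hgood := le_measure_pi_goodSamples θ.pmf.toMeasure (k + 2)
    (γ := tauStar d α β h / (16 * 2 ^ k)) (by positivity)
    (pos_of_sampleBound_le hd hα hβ hζ hζ1 (one_le_two.trans hp) hn)
  have hfail := card_mul_exp_le hp hζ hζ1
    (three_mul_add_one_mul_le_of_sampleCoeff_mul_le hd hα hβ hh hlog hn hkle)
  refine le_trans (by linarith) (hgood.trans (measureReal_mono fun X hX u R hR => ?_))
  refine hR.eq_neighborFinset hG hθ hα hαβ hτ hτle fun i S hS hi =>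
    abs_empInfluence_sub_le hX hτ.le (Nat.le_floor ?_) hi
  linarith [one_div_tauStar_sq (d := d) (α := α) (β := β) (h := h),
    ellStar_nonneg (d := d) (α := α) (β := β) (h := h)]

theorem exists_returns_learnProg (X : Samples p n) (u : Fin p) (hτ : 0 < τ) :
    ∃ t R, LearnNbhd X τ u R ∧ Returns learnProg X τ u t R ∧
      (t : ℝ) ≤ 200 * ((1 / τ ^ 2 + 1) * ((p + 1) * (n + 1))) := by
  obtain ⟨t, S, R, hS, hR, hret, ht⟩ := learnProg_spec X u hτ
  refine ⟨t, R, hR, hret, ?_⟩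
  calc (t : ℝ) ≤ 200 * ((S.card + 1) * ((p + 1) * (n + 1))) := by exact_mod_cast ht
    _ ≤ _ := by
        gcongr
        exact hS.1.card_le hτ

theorem mul_one_div_tauStar_sq_add_one_le (hd : 1 ≤ d) (hα : 0 < α) (hαβ : α ≤ β) (hh : 0 ≤ h)
    (hp : 1 ≤ p) (hn : 1 ≤ n) :
    200 * ((1 / tauStar d α β h ^ 2 + 1) * (((p : ℝ) + 1) * (n + 1))) ≤
      800 * ellStar d α β h * p * n := by
  have hp' : (1 : ℝ) ≤ p := by exact_mod_cast hp
  have hn' : (1 : ℝ) ≤ n := by exact_mod_cast hn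
  have hℓ := eight_le_ellStar hd hα hαβ hh
  calc 200 * ((1 / tauStar d α β h ^ 2 + 1) * (((p : ℝ) + 1) * (n + 1)))
      ≤ 200 * (ellStar d α β h * (2 * p * (2 * n))) := by
        rw [one_div_tauStar_sq]
        gcongr <;> linarith
    _ = 800 * ellStar d α β h * p * n := by ring

theorem ceil_sampleBound_le (hd : 1 ≤ d) (hα : 0 < α) (hβ : 0 < β) (hζ : ζ ≠ 0) (hp : 2 ≤ p) :
    (⌈sampleBound d α β h ζ p⌉₊ : ℝ) ≤
      (sampleCoeff d α β h * (1 + 2 * |Real.log ζ|) + 2) * Real.log p := by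
  have hc := sampleCoeff_pos (h := h) hd hα hβ
  have hlogp : 1 ≤ 2 * Real.log p := by
    linarith [Real.log_two_gt_d9, Real.log_le_log two_pos (by exact_mod_cast hp : (2 : ℝ) ≤ p)]
  have hle : sampleBound d α β h ζ p ≤
      sampleCoeff d α β h * (1 + 2 * |Real.log ζ|) * Real.log p := by
    rw [sampleBound, mul_assoc, Real.log_div (by positivity) hζ]
    refine mul_le_mul_of_nonneg_left ?_ hc.le
    nlinarith [neg_le_abs (Real.log ζ), abs_nonneg (Real.log ζ)]
  have hnonneg : 0 ≤ sampleCoeff d α β h * (1 + 2 * |Real.log ζ|) * Real.log p :=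
    mul_nonneg (by positivity) (by linarith)
  calc (⌈sampleBound d α β h ζ p⌉₊ : ℝ)
      ≤ ⌈sampleCoeff d α β h * (1 + 2 * |Real.log ζ|) * Real.log p⌉₊ := by
        exact_mod_cast Nat.ceil_le_ceil hle
    _ ≤ sampleCoeff d α β h * (1 + 2 * |Real.log ζ|) * Real.log p + 1 :=
        (Nat.ceil_lt_add_one hnonneg).le
    _ ≤ _ := by linarith

theorem le_mul_ellStar_mul_of_sampleBound_le (hd : 1 ≤ d) (hα : 0 < α) (hαβ : α ≤ β) (hh : 0 ≤ h)
    (hζ : 0 < ζ) (hζ1 : ζ < 1) (hn : sampleBound d α β h ζ p ≤ n) {t : ℕ}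
    (ht : (t : ℝ) ≤ 200 * ((1 / tauStar d α β h ^ 2 + 1) * ((p + 1) * (n + 1)))) (u : Fin p) :
    (t : ℝ) ≤ 800 * ellStar d α β h * p * n :=
  ht.trans (mul_one_div_tauStar_sq_add_one_le hd hα hαβ hh u.pos
    (pos_of_sampleBound_le hd hα (hα.trans_le hαβ) hζ hζ1 u.pos hn))

theorem mul_ellStar_mul_ceil_sampleBound_le (hd : 1 ≤ d) (hα : 0 < α) (hβ : 0 < β) (hζ : ζ ≠ 0)
    (hp : 2 ≤ p) :
    800 * ellStar d α β h * p * ⌈sampleBound d α β h ζ p⌉₊ ≤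
      800 * ellStar d α β h * (sampleCoeff d α β h * (1 + 2 * |Real.log ζ|) + 2) *
        (p * Real.log p) := by
  have hℓ := ellStar_nonneg (d := d) (α := α) (β := β) (h := h)
  calc 800 * ellStar d α β h * p * ⌈sampleBound d α β h ζ p⌉₊
      ≤ 800 * ellStar d α β h * p *
          ((sampleCoeff d α β h * (1 + 2 * |Real.log ζ|) + 2) * Real.log p) := by
        gcongr
        exact ceil_sampleBound_le hd hα hβ hζ hp
    _ = _ := by ring

end

end IsingLearn

open IsingLearn

theorem theorem1 :
    ∃ (prog : Prog) (T : (p n : ℕ) → Samples p n → ℝ → Fin p → ℕ),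
      -- the program implements the algorithm, and `T` is its running time
      (∀ (p n : ℕ) (X : Samples p n) (τ : ℝ) (u : Fin p), 0 < τ →
        ∃ R : Finset (Fin p), LearnNbhd X τ u R ∧ Returns prog X τ u (T p n X τ u) R) ∧
      ∃ C c c' c'' : ℝ, 0 < C ∧ 0 < c ∧ 0 < c' ∧ 0 < c'' ∧
        ∀ (d : ℕ) (α β h ζ : ℝ), 1 ≤ d → 0 < α → α ≤ β → 0 ≤ h → 0 < ζ →
          -- the order of the number of samples
          sampleCoeff d α β h ≤
            Real.exp (c * α ^ (-c') * Real.exp (c'' * d * (β * d + h + 1))) ∧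
          -- correctness and running time
          (∀ (p n : ℕ) (G : SimpleGraph (Fin p)) [DecidableRel G.Adj] (θ : Param p),
            (∀ i, G.degree i ≤ d) → θ.Valid G α β h → sampleBound d α β h ζ p ≤ n →
            1 - ζ ≤ (θ.sampleLaw n).real {X | ∀ u : Fin p,
              (∀ R, LearnNbhd X (tauStar d α β h) u R → R = G.neighborFinset u) ∧
              (T p n X (tauStar d α β h) u : ℝ) ≤ C * ellStar d α β h * p * n}) ∧
          -- with the smallest admissible number of samples, the running time is of order
          -- `p log p` for each node and `p² log p` in total
          ∃ K : ℝ, ∀ (p n : ℕ) (G : SimpleGraph (Fin p)) [DecidableRel G.Adj] (θ : Param p),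
            (∀ i, G.degree i ≤ d) → θ.Valid G α β h → 2 ≤ p → n = ⌈sampleBound d α β h ζ p⌉₊ →
            1 - ζ ≤ (θ.sampleLaw n).real {X |
              (∀ u : Fin p,
                (∀ R, LearnNbhd X (tauStar d α β h) u R → R = G.neighborFinset u) ∧
                (T p n X (tauStar d α β h) u : ℝ) ≤ K * (p * Real.log p)) ∧
              ∑ u : Fin p, (T p n X (tauStar d α β h) u : ℝ) ≤ K * (p ^ 2 * Real.log p)} := by
  choose! T R hR hret hT using @exists_returns_learnProg
  refine ⟨learnProg, fun p n X τ u => @T p n τ X u, fun p n X τ u hτ => ⟨_, hR X u hτ, hret X u hτ⟩,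
    800, 12288, 4, 23, by norm_num, by norm_num, by norm_num, by norm_num,
    fun d α β h ζ hd hα hαβ hh hζ => ⟨sampleCoeff_le hd hα hαβ hh, ?_⟩⟩
  have hβ := hα.trans_le hαβ
  rcases le_or_gt 1 ζ with hζ1 | hζ1
  · have htriv {p n : ℕ} (θ : Param p) (A : Set (Samples p n)) : 1 - ζ ≤ (θ.sampleLaw n).real A :=
      (sub_nonpos.2 hζ1).trans measureReal_nonneg
    exact ⟨fun _ _ _ _ θ _ _ _ => htriv θ _, 0, fun _ _ _ _ θ _ _ _ _ => htriv θ _⟩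
  have htime {p n : ℕ} (X : Samples p n) (u : Fin p) (hn : sampleBound d α β h ζ p ≤ n) :=
    le_mul_ellStar_mul_of_sampleBound_le hd hα hαβ hh hζ hζ1 hn (hT X u (tauStar_pos hd hα hβ)) u
  refine ⟨fun p n G _ θ hG hθ hn => ?_, 800 * ellStar d α β h *
    (sampleCoeff d α β h * (1 + 2 * |Real.log ζ|) + 2), fun p n G _ θ hG hθ hp hn => ?_⟩
  · exact (le_sampleLaw_learnNbhd_eq hG hθ hd hα hαβ hh hζ hζ1 hn).trans
      (measureReal_mono fun X hX u => ⟨hX u, htime X u hn⟩)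
  · subst hn
    refine (le_sampleLaw_learnNbhd_eq hG hθ hd hα hαβ hh hζ hζ1 (Nat.le_ceil _)).trans
      (measureReal_mono fun X hX => ?_)
    have hlog (u : Fin p) := (htime X u (Nat.le_ceil _)).trans
      (mul_ellStar_mul_ceil_sampleBound_le hd hα hβ hζ.ne' hp)
    exact ⟨fun u => ⟨hX u, hlog u⟩, (Finset.sum_le_card_nsmul _ _ _ fun u _ => hlog u).trans_eq
      (by rw [Finset.card_univ, Fintype.card_fin, nsmul_eq_mul]; ring)⟩
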